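/- Let $N\ge 2$ and let $\Omega\subset\mathbb R^N$ be a bounded domain (nonempty, open, connected) with Lipschitz boundary. Let $\mathscr C$ be the set of all continuous $p:\overline\Omega\to\mathbb R$ such that $1<\inf_\Omega p\le\sup_\Omega p<N$ and such that, for some $L>0$, $$|p(x)-p(y)|\le-\frac{L}{\log|x-y|}\qquad\text{for all }x,y\in\Omega\text{ with }0<|x-y|\le\tfrac12 .$$ For $p\in\mathscr C$ let $\varrho_{p(x)}(f)=\int_\Omega|f(x)|^{p(x)}\,dx$. The space $L^{p(x)}(\Omega)$ consists of the measurable $f$ with $\varrho_{p(x)}(f)<\infty$, and has the Luxemburg norm $\|f\|_{p(x)}=\inf\{\gamma>0:\varrho_{p(x)}(f/\gamma)\le1\}$. The space $W^{1,p(x)}(\Omega)$ consists of the $u\in L^{p(x)}(\Omega)$ whose distributional gradient $\nabla u$ is in $L^{p(x)}(\Omega)$, and $W^{1,p(x)}_0(\Omega)$ is the closure in it of $C^\infty_{\mathrm c}(\Omega)$ for the norm $\|u\|_{p(x)}+\|\nabla u\|_{p(x)}$. Define $\mathscr E_{p(x)}:L^1(\Omega)\to[0,\infty]$ by $$\mathscr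 E_{p(x)}(u)=\begin{cases}\|\nabla u\|_{p(x)}&\text{if }u\in W^{1,p(x)}_0(\Omega),\\+\infty&\text{otherwise.}\end{cases}$$ For functions $f_h:L^1(\Omega)\to[0,\infty]$, $h\in\mathbb N$, and $u\in L^1(\Omega)$ put $$\Big(\Gamma\text{-}\liminf_{h\to\infty}f_h\Big)(u)=\sup_{U}\ \liminf_{h\to\infty}\ \inf_{v\in U}f_h(v),$$ where $U$ ranges over the open neighbourhoods of $u$ in the norm topology of $L^1(\Omega)$. Let $p\in\mathscr C$ and $p_h\in\mathscr C$ for $h\in\mathbb N$ be such that $p(x)\le p_h(x)$ for all $h\in\mathbb N$ and $x\in\Omega$, and $p_h\to p$ uniformly in $\Omega$. Then $$\mathscr E_{p(x)}(u)\le\Big(\Gamma\text{-}\liminf_{h\to\infty}\mathscr E_{p_h(x)}\Big)(u)\qquad\text{for all }u\in L^1(\Omega).$$ -/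

import Mathlib

open MeasureTheory Filter Topology
open scoped ENNReal NNReal ContDiff

noncomputable section

namespace VarExp

variable {N : ℕ}

/-- The boundary of `Ω` is Lipschitz: near each boundary point, `Ω` is the strict epigraph, in some
direction `e`, of a Lipschitz function defined on the hyperplane orthogonal to `e`. -/
def HasLipschitzBoundary (Ω : Set (EuclideanSpace ℝ (Fin N))) : Prop :=
  ∀ x ∈ frontier Ω, ∃ e : EuclideanSpace ℝ (Fin N), ‖e‖ = 1 ∧
    ∃ r : ℝ, 0 < r ∧ ∃ (K : ℝ≥0) (g : (Submodule.span ℝ {e})ᗮ → ℝ), LipschitzWith K g ∧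
      ∀ y ∈ Metric.ball x r,
        (y ∈ Ω ↔ g ((Submodule.span ℝ {e})ᗮ.orthogonalProjectionOnto y) < inner ℝ e y)

/-- The class of admissible variable exponents on `Ω`. The conditions `one_lt_inf` and `sup_lt` say
`1 < inf_Ω p` and `sup_Ω p < N`. -/
structure IsAdmissible (Ω : Set (EuclideanSpace ℝ (Fin N)))
    (p : EuclideanSpace ℝ (Fin N) → ℝ) : Prop where
  continuousOn : ContinuousOn p (closure Ω)
  one_lt_inf : ∃ a : ℝ, 1 < a ∧ ∀ x ∈ Ω, a ≤ p x
  sup_lt : ∃ b : ℝ, b < (N : ℝ) ∧ ∀ x ∈ Ω, p x ≤ b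
  logHolder : ∃ L : ℝ, 0 < L ∧ ∀ x ∈ Ω, ∀ y ∈ Ω, 0 < ‖x - y‖ → ‖x - y‖ ≤ 1 / 2 →
    |p x - p y| ≤ -(L / Real.log ‖x - y‖)

/-- The `p(x)`-modular `∫_Ω |f(x)|^{p(x)} dx`, for scalar or vector-valued `f`. -/
def modular {F : Type*} [NormedAddCommGroup F] (Ω : Set (EuclideanSpace ℝ (Fin N)))
    (p : EuclideanSpace ℝ (Fin N) → ℝ) (f : EuclideanSpace ℝ (Fin N) → F) : ℝ≥0∞ :=
  ∫⁻ x in Ω, ENNReal.ofReal (‖f x‖ ^ p x)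

/-- Membership in the variable exponent Lebesgue space `L^{p(x)}(Ω)`. -/
def MemLpVar {F : Type*} [NormedAddCommGroup F] (Ω : Set (EuclideanSpace ℝ (Fin N)))
    (p : EuclideanSpace ℝ (Fin N) → ℝ) (f : EuclideanSpace ℝ (Fin N) → F) : Prop :=
  AEStronglyMeasurable f (volume.restrict Ω) ∧ modular Ω p f < ⊤

/-- The Luxemburg norm `inf {γ > 0 : ϱ_{p(x)}(f / γ) ≤ 1}`, with value `∞` if there is no such `γ`. -/
def luxNorm {F : Type*} [NormedAddCommGroup F] [NormedSpace ℝ F]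
    (Ω : Set (EuclideanSpace ℝ (Fin N))) (p : EuclideanSpace ℝ (Fin N) → ℝ)
    (f : EuclideanSpace ℝ (Fin N) → F) : ℝ≥0∞ :=
  ⨅ (γ : ℝ) (_ : 0 < γ) (_ : modular Ω p (fun x => γ⁻¹ • f x) ≤ 1), ENNReal.ofReal γ

/-- `φ` is a smooth function with compact support in `Ω`. -/
def IsTestFunction (Ω : Set (EuclideanSpace ℝ (Fin N)))
    (φ : EuclideanSpace ℝ (Fin N) → ℝ) : Prop :=
  ContDiff ℝ ∞ φ ∧ HasCompactSupport φ ∧ tsupport φ ⊆ Ω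

/-- `G` is a distributional gradient of `u` on `Ω`. -/
def HasWeakGradient (Ω : Set (EuclideanSpace ℝ (Fin N))) (u : EuclideanSpace ℝ (Fin N) → ℝ)
    (G : EuclideanSpace ℝ (Fin N) → EuclideanSpace ℝ (Fin N)) : Prop :=
  LocallyIntegrableOn u Ω ∧ LocallyIntegrableOn G Ω ∧
    ∀ φ : EuclideanSpace ℝ (Fin N) → ℝ, IsTestFunction Ω φ → ∀ e : EuclideanSpace ℝ (Fin N),
      ∫ x in Ω, u x * fderiv ℝ φ x e = -∫ x in Ω, φ x * inner ℝ (G x) e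

open Classical in
/-- The distributional gradient of `u` on `Ω` (unique up to null sets) where it exists as a locally
integrable field; `0` otherwise. -/
def weakGradient (Ω : Set (EuclideanSpace ℝ (Fin N))) (u : EuclideanSpace ℝ (Fin N) → ℝ) :
    EuclideanSpace ℝ (Fin N) → EuclideanSpace ℝ (Fin N) :=
  if h : ∃ G, HasWeakGradient Ω u G then h.choose else 0

/-- Membership in the variable exponent Sobolev space `W^{1,p(x)}(Ω)`. -/
def MemW1 (Ω : Set (EuclideanSpace ℝ (Fin N))) (p : EuclideanSpace ℝ (Fin N) → ℝ)
    (u : EuclideanSpace ℝ (Fin N) → ℝ) : Prop :=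
  MemLpVar Ω p u ∧ (∃ G, HasWeakGradient Ω u G) ∧ MemLpVar Ω p (weakGradient Ω u)

/-- Membership in `W_0^{1,p(x)}(Ω)`, the closure of the test functions in `W^{1,p(x)}(Ω)` for the
norm `‖u‖_{p(x)} + ‖∇u‖_{p(x)}`. -/
def MemW10 (Ω : Set (EuclideanSpace ℝ (Fin N))) (p : EuclideanSpace ℝ (Fin N) → ℝ)
    (u : EuclideanSpace ℝ (Fin N) → ℝ) : Prop :=
  MemW1 Ω p u ∧ ∀ ε : ℝ≥0∞, 0 < ε → ∃ φ : EuclideanSpace ℝ (Fin N) → ℝ, IsTestFunction Ω φ ∧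
    luxNorm Ω p (fun x => u x - φ x) +
      luxNorm Ω p (fun x => weakGradient Ω u x - gradient φ x) < ε

open Classical in
/-- The functional on `L¹(Ω)` equal to `‖∇u‖_{p(x)}` on `W_0^{1,p(x)}(Ω)` and to `+∞` elsewhere. -/
def energy (Ω : Set (EuclideanSpace ℝ (Fin N))) (p : EuclideanSpace ℝ (Fin N) → ℝ)
    (u : Lp ℝ 1 (volume.restrict Ω)) : ℝ≥0∞ :=
  if MemW10 Ω p u then luxNorm Ω p (weakGradient Ω u) else ⊤

/-- The `Γ`-lower limit of a sequence of functions, at `u`: the supremum over open neighbourhoods `U`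
of `u` of the lower limit of `inf_U f_h`. -/
def gammaLiminf {X Y : Type*} [TopologicalSpace X] [CompleteLinearOrder Y] (f : ℕ → X → Y)
    (u : X) : Y :=
  ⨆ (U : Set X) (_ : IsOpen U) (_ : u ∈ U), liminf (fun h => ⨅ v ∈ U, f h v) atTop

end VarExp

end

/-!
If the `Γ`-lower limit at `u` is below `m`, then arbitrarily `L¹`-close to `u` there are test
functions `φ` with `‖∇φ‖_{p_h(x)} < m`, and the weighted AM–GM inequality
`s ^ p ≤ s ^ q + (q - p)` turns this into `∫ |∇φ / m| ^ p(x) ≤ 1 + ‖p_h - p‖_{L¹}`. Hence the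
lower semicontinuous relaxation of the modular of `∇φ / m` from test functions is at most `1` at
`u`. As `p` is bounded away from `1`, the modular is uniformly convex, and midpoints of test
functions near `u` remain near `u`, so a sequence realising the relaxation has a Cauchy sequence
of gradients. A Sobolev inequality for modulars, proved by raising the exponent in steps of
`1 / N` on small balls where `p` oscillates little, makes the functions converge in `L^{p(x)}` as
well. Thus `u` is in `W_0^{1,p(x)}` and `‖∇u‖_{p(x)} ≤ m` by Fatou's lemma.
-/

namespace VarExp

section Pointwise

variable {E : Type*} [NormedAddCommGroup E]

theorem rpow_le_one_add_rpow {s p q : ℝ} (hs : 0 ≤ s) (hp : 0 ≤ p) (hpq : p ≤ q) :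
    s ^ p ≤ 1 + s ^ q := by
  rcases le_total s 1 with h | h
  · linarith [Real.rpow_le_one hs h hp, Real.rpow_nonneg hs q]
  · linarith [Real.rpow_le_rpow_of_exponent_le h hpq]

theorem rpow_le_rpow_add_sub {s p q : ℝ} (hs : 0 ≤ s) (hp : 1 ≤ p) (hpq : p ≤ q) :
    s ^ p ≤ s ^ q + (q - p) := by
  have hq : 0 < q := by linarith
  have weighted_amgm : s ^ p ≤ p / q * s ^ q + (1 - p / q) := by
    have h := Real.geom_mean_le_arith_mean2_weighted (w₁ := p / q) (w₂ := 1 - p / q)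
      (by positivity) (sub_nonneg.2 ((div_le_one hq).2 hpq)) (Real.rpow_nonneg hs q)
      zero_le_one (by ring)
    rwa [Real.one_rpow, ← Real.rpow_mul hs, mul_div_cancel₀ _ hq.ne', mul_one, mul_one] at h
  have hfst : p / q * s ^ q ≤ s ^ q :=
    mul_le_of_le_one_left (Real.rpow_nonneg hs q) ((div_le_one hq).2 hpq)
  have hsnd : 1 - p / q ≤ q - p := by
    rw [one_sub_div hq.ne', div_le_iff₀ hq]
    nlinarith
  linarith

theorem norm_add_rpow_le {p b : ℝ} (hp : 0 ≤ p) (hb : p ≤ b) (x y : E) :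
    ‖x + y‖ ^ p ≤ 2 ^ b * (‖x‖ ^ p + ‖y‖ ^ p) := by
  have hx := Real.rpow_nonneg (norm_nonneg x) p
  have hy := Real.rpow_nonneg (norm_nonneg y) p
  calc ‖x + y‖ ^ p ≤ (2 * max ‖x‖ ‖y‖) ^ p := by
        refine Real.rpow_le_rpow (norm_nonneg _) ?_ hp
        linarith [norm_add_le x y, le_max_left ‖x‖ ‖y‖, le_max_right ‖x‖ ‖y‖]
    _ = 2 ^ p * max ‖x‖ ‖y‖ ^ p :=
        Real.mul_rpow zero_le_two (le_max_of_le_left (norm_nonneg x))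
    _ ≤ 2 ^ b * (‖x‖ ^ p + ‖y‖ ^ p) := by
        gcongr
        · exact one_le_two
        · rcases max_choice ‖x‖ ‖y‖ with h | h <;> rw [h] <;> linarith

variable [NormedSpace ℝ E]

theorem convexOn_norm_rpow {p : ℝ} (hp : 1 ≤ p) :
    ConvexOn ℝ Set.univ fun x : E => ‖x‖ ^ p := by
  refine ⟨convex_univ, fun x _ y _ v w hv hw hvw => ?_⟩
  calc ‖v • x + w • y‖ ^ p ≤ (v • ‖x‖ + w • ‖y‖) ^ p :=
        Real.rpow_le_rpow (norm_nonneg _)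
          (convexOn_univ_norm.2 (Set.mem_univ x) (Set.mem_univ y) hv hw hvw)
          (zero_le_one.trans hp)
    _ ≤ v • ‖x‖ ^ p + w • ‖y‖ ^ p :=
        (convexOn_rpow hp).2 (norm_nonneg x) (norm_nonneg y) hv hw hvw

theorem two_mul_norm_midpoint_rpow_lt [StrictConvexSpace ℝ E] {p : ℝ} (hp : 1 < p) {x y : E}
    (hxy : x ≠ y) : 2 * ‖(1 / 2 : ℝ) • (x + y)‖ ^ p < ‖x‖ ^ p + ‖y‖ ^ p := by
  by_cases h : ‖x‖ = ‖y‖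
  · rw [← h, ← two_mul]
    have : 0 < p := by linarith
    gcongr
    exact (norm_midpoint_lt_iff h).2 hxy
  · have hmid : ‖(1 / 2 : ℝ) • (x + y)‖ ≤ (1 / 2 : ℝ) • ‖x‖ + (1 / 2 : ℝ) • ‖y‖ := by
      rw [smul_add]
      exact (norm_add_le _ _).trans_eq (by simp only [norm_smul, smul_eq_mul]; norm_num)
    have hpow := (strictConvexOn_rpow hp).2 (Set.mem_Ici.2 (norm_nonneg x))
      (Set.mem_Ici.2 (norm_nonneg y)) h one_half_pos one_half_pos (add_halves 1)
    have := (Real.rpow_le_rpow (norm_nonneg _) hmid (by linarith)).trans_lt hpow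
    simp only [smul_eq_mul] at this
    linarith

theorem exists_forall_le_add_mul {X : Type*} [TopologicalSpace X] {K : Set X} (hK : IsCompact K)
    {f h : X → ℝ} (hf : ContinuousOn f K) (hh : ContinuousOn h K) (h_nonneg : ∀ x ∈ K, 0 ≤ h x)
    (hfh : ∀ x ∈ K, h x = 0 → f x ≤ 0) {ε : ℝ} (hε : 0 < ε) :
    ∃ C : ℝ, 0 ≤ C ∧ ∀ x ∈ K, f x ≤ ε + C * h x := by
  obtain ⟨M, hM⟩ := hK.bddAbove_image hf
  have hfM : ∀ x ∈ K, f x ≤ max M 0 := fun x hx =>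
    le_max_of_le_left (hM (Set.mem_image_of_mem f hx))
  have hh' : ContinuousOn h {x ∈ K | ε ≤ f x} := hh.mono fun _ hx => hx.1
  have hK' : IsCompact {x ∈ K | ε ≤ f x} :=
    hf.upperSemicontinuousOn.isCompact_inter_preimage_Ici hK ε
  obtain ⟨d, hd, hdh⟩ := hK'.exists_forall_le' hh' (a := 0) fun x hx =>
    (h_nonneg x hx.1).lt_of_ne fun h0 => (hε.trans_le hx.2).not_ge (hfh x hx.1 h0.symm)
  refine ⟨max M 0 / d, by positivity, fun x hx => ?_⟩
  have hCh : 0 ≤ max M 0 / d * h x := mul_nonneg (by positivity) (h_nonneg x hx)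
  rcases lt_or_ge (f x) ε with hlt | hge
  · linarith
  · calc f x ≤ max M 0 / d * d := by rw [div_mul_cancel₀ _ hd.ne']; exact hfM x hx
      _ ≤ max M 0 / d * h x := by gcongr; exact hdh x ⟨hx, hge⟩
      _ ≤ ε + max M 0 / d * h x := by linarith

theorem exists_uniform_convexity_of_norm_eq_one [StrictConvexSpace ℝ E] [ProperSpace E]
    {a : ℝ} (b : ℝ) (ha : 1 < a) {ε : ℝ} (hε : 0 < ε) :
    ∃ C : ℝ, 0 ≤ C ∧ ∀ p ∈ Set.Icc a b, ∀ x y : E, ‖(x, y)‖ = 1 →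
      ‖x - y‖ ^ p ≤ ε + C * (‖x‖ ^ p + ‖y‖ ^ p - 2 * ‖(1 / 2 : ℝ) • (x + y)‖ ^ p) := by
  have rpow_continuousOn {g : ℝ × E × E → E} (hg : Continuous g) :
      ContinuousOn (fun z => ‖g z‖ ^ z.1) (Set.Icc a b ×ˢ Metric.sphere (0 : E × E) 1) :=
    hg.norm.continuousOn.rpow continuousOn_fst fun z hz =>
      Or.inr (by linarith [hz.1.1])
  have hlt : ∀ z ∈ Set.Icc a b ×ˢ Metric.sphere (0 : E × E) 1, z.2.1 ≠ z.2.2 →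
      0 < ‖z.2.1‖ ^ z.1 + ‖z.2.2‖ ^ z.1 - 2 * ‖(1 / 2 : ℝ) • (z.2.1 + z.2.2)‖ ^ z.1 :=
    fun z hz hne => sub_pos.2 (two_mul_norm_midpoint_rpow_lt (ha.trans_le hz.1.1) hne)
  have heq : ∀ z : ℝ × E × E, z.2.1 = z.2.2 →
      ‖z.2.1‖ ^ z.1 + ‖z.2.2‖ ^ z.1 - 2 * ‖(1 / 2 : ℝ) • (z.2.1 + z.2.2)‖ ^ z.1 = 0 := by
    intro z hz
    rw [hz, ← two_smul ℝ z.2.2, smul_smul]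
    norm_num
    ring
  obtain ⟨C, hC, hle⟩ := exists_forall_le_add_mul
    (isCompact_Icc.prod (isCompact_sphere (0 : E × E) 1))
    (rpow_continuousOn (g := fun z => z.2.1 - z.2.2) (by fun_prop))
    (((rpow_continuousOn (g := fun z => z.2.1) (by fun_prop)).add
      (rpow_continuousOn (g := fun z => z.2.2) (by fun_prop))).sub
      ((rpow_continuousOn (g := fun z => (1 / 2 : ℝ) • (z.2.1 + z.2.2)) (by fun_prop)).const_mul 2))
    (fun z hz => by
      by_cases hne : z.2.1 = z.2.2
      exacts [(heq z hne).ge, (hlt z hz hne).le])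
    (fun z hz h0 => by
      have hz2 : z.2.1 = z.2.2 := by_contra fun hne => (hlt z hz hne).ne' h0
      have : z.1 ≠ 0 := by linarith [hz.1.1]
      simp [hz2, this]) hε
  exact ⟨C, hC, fun p hp x y hxy => hle (p, x, y) ⟨hp, by simpa using hxy⟩⟩

theorem exists_uniform_convexity [StrictConvexSpace ℝ E] [ProperSpace E]
    {a : ℝ} (b : ℝ) (ha : 1 < a) {ε : ℝ} (hε : 0 < ε) :
    ∃ C : ℝ, 0 ≤ C ∧ ∀ p ∈ Set.Icc a b, ∀ x y : E,
      ‖x - y‖ ^ p + 2 * C * ‖(1 / 2 : ℝ) • (x + y)‖ ^ p ≤ (ε + C) * (‖x‖ ^ p + ‖y‖ ^ p) := by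
  obtain ⟨C, hC, hle⟩ := exists_uniform_convexity_of_norm_eq_one (E := E) b ha hε
  refine ⟨C, hC, fun p hp x y => ?_⟩
  have hp0 : 0 < p := by linarith [hp.1]
  rcases eq_or_ne (x, y) 0 with h0 | h0
  · obtain ⟨rfl, rfl⟩ := Prod.mk_eq_zero.1 h0
    simp [hp0.ne']
  obtain ⟨t, ht, x, y, hxy, rfl, rfl⟩ :
      ∃ t : ℝ, 0 < t ∧ ∃ x' y' : E, ‖(x', y')‖ = 1 ∧ x = t • x' ∧ y = t • y' := by
    have ht := norm_pos_iff.2 h0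
    refine ⟨‖(x, y)‖, ht, ‖(x, y)‖⁻¹ • x, ‖(x, y)‖⁻¹ • y, ?_,
      (smul_inv_smul₀ ht.ne' x).symm, (smul_inv_smul₀ ht.ne' y).symm⟩
    exact norm_smul_inv_norm (𝕜 := ℝ) h0
  have norm_smul_rpow (w : E) : ‖t • w‖ ^ p = t ^ p * ‖w‖ ^ p := by
    rw [norm_smul, Real.norm_of_nonneg ht.le, Real.mul_rpow ht.le (norm_nonneg w)]
  have one_le : 1 ≤ ‖x‖ ^ p + ‖y‖ ^ p := by
    have hx := Real.rpow_nonneg (norm_nonneg x) p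
    have hy := Real.rpow_nonneg (norm_nonneg y) p
    rcases max_choice ‖x‖ ‖y‖ with h | h <;> rw [Prod.norm_mk, h] at hxy <;>
      rw [hxy, Real.one_rpow] <;> linarith
  rw [← smul_sub, ← smul_add, smul_comm (1 / 2 : ℝ) t]
  simp only [norm_smul_rpow]
  calc _ = t ^ p * (‖x - y‖ ^ p + 2 * C * ‖(1 / 2 : ℝ) • (x + y)‖ ^ p) := by ring
    _ ≤ t ^ p * ((ε + C) * (‖x‖ ^ p + ‖y‖ ^ p)) := by
        gcongr
        nlinarith [hle p hp x y hxy]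
    _ = _ := by ring

end Pointwise

section Modular

variable {N : ℕ} {Ω : Set (EuclideanSpace ℝ (Fin N))} {p q : EuclideanSpace ℝ (Fin N) → ℝ}
  {F : Type*} [NormedAddCommGroup F]

theorem modular_congr_ae {f g : EuclideanSpace ℝ (Fin N) → F}
    (h : f =ᵐ[volume.restrict Ω] g) : modular Ω p f = modular Ω p g :=
  lintegral_congr_ae (h.mono fun x hx => by simp only [hx])

theorem modular_mono_norm {F' : Type*} [NormedAddCommGroup F'] (hΩ : MeasurableSet Ω)
    (hp : ∀ x ∈ Ω, 0 ≤ p x) {f : EuclideanSpace ℝ (Fin N) → F}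
    {g : EuclideanSpace ℝ (Fin N) → F'} (h : ∀ x ∈ Ω, ‖f x‖ ≤ ‖g x‖) :
    modular Ω p f ≤ modular Ω p g :=
  setLIntegral_mono' hΩ fun x hx =>
    ENNReal.ofReal_le_ofReal (Real.rpow_le_rpow (norm_nonneg _) (h x hx) (hp x hx))

theorem modular_const {r : ℝ≥0} (hr : r ≠ 0) (f : EuclideanSpace ℝ (Fin N) → F) :
    modular Ω (fun _ => (r : ℝ)) f = eLpNorm f r (volume.restrict Ω) ^ (r : ℝ) := by
  rw [eLpNorm_nnreal_pow_eq_lintegral hr]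
  simp only [modular, ← ENNReal.ofReal_rpow_of_nonneg (norm_nonneg _) r.coe_nonneg, ofReal_norm]

theorem modular_one (f : EuclideanSpace ℝ (Fin N) → F) :
    modular Ω (fun _ => 1) f = eLpNorm f 1 (volume.restrict Ω) := by
  simpa using modular_const one_ne_zero f

theorem modular_le_measure_add (hΩ : MeasurableSet Ω) (hp : ∀ x ∈ Ω, 0 ≤ p x)
    (hpq : ∀ x ∈ Ω, p x ≤ q x) (f : EuclideanSpace ℝ (Fin N) → F) :
    modular Ω p f ≤ volume Ω + modular Ω q f := by
  calc modular Ω p f ≤ ∫⁻ x in Ω, (1 + ENNReal.ofReal (‖f x‖ ^ q x)) := by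
        refine setLIntegral_mono' hΩ fun x hx => ?_
        rw [← ENNReal.ofReal_one, ← ENNReal.ofReal_add zero_le_one (by positivity)]
        exact ENNReal.ofReal_le_ofReal
          (rpow_le_one_add_rpow (norm_nonneg _) (hp x hx) (hpq x hx))
    _ = volume Ω + modular Ω q f := by
        rw [lintegral_add_left measurable_const, setLIntegral_one, modular]

theorem modular_le_modular_add (hΩ : MeasurableSet Ω) (hp : ∀ x ∈ Ω, 1 ≤ p x)
    (hpq : ∀ x ∈ Ω, p x ≤ q x) (hpm : AEMeasurable p (volume.restrict Ω))
    (hqm : AEMeasurable q (volume.restrict Ω)) (f : EuclideanSpace ℝ (Fin N) → F) :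
    modular Ω p f ≤ modular Ω q f + eLpNorm (q - p) 1 (volume.restrict Ω) := by
  rw [eLpNorm_one_eq_lintegral_enorm, modular, modular,
    ← lintegral_add_right' _ (hqm.sub hpm).enorm]
  refine setLIntegral_mono' hΩ fun x hx => ?_
  have hsub : 0 ≤ q x - p x := sub_nonneg.2 (hpq x hx)
  rw [Pi.sub_apply, Real.enorm_of_nonneg hsub, ← ENNReal.ofReal_add (by positivity) hsub]
  exact ENNReal.ofReal_le_ofReal (rpow_le_rpow_add_sub (norm_nonneg _) (hp x hx) (hpq x hx))

theorem aemeasurable_ofReal_norm_rpow {f : EuclideanSpace ℝ (Fin N) → F}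
    (hp : AEMeasurable p (volume.restrict Ω)) (hf : AEStronglyMeasurable f (volume.restrict Ω)) :
    AEMeasurable (fun x => ENNReal.ofReal (‖f x‖ ^ p x)) (volume.restrict Ω) :=
  (hf.norm.aemeasurable.pow hp).ennreal_ofReal

theorem modular_add_le {b : ℝ} (hΩ : MeasurableSet Ω) (hp : ∀ x ∈ Ω, 0 ≤ p x)
    (hpb : ∀ x ∈ Ω, p x ≤ b) (hpm : AEMeasurable p (volume.restrict Ω))
    {f : EuclideanSpace ℝ (Fin N) → F} (hf : AEStronglyMeasurable f (volume.restrict Ω))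
    (g : EuclideanSpace ℝ (Fin N) → F) :
    modular Ω p (f + g) ≤ ENNReal.ofReal (2 ^ b) * (modular Ω p f + modular Ω p g) := by
  unfold modular
  rw [← lintegral_add_left' (aemeasurable_ofReal_norm_rpow hpm hf),
    ← lintegral_const_mul' _ _ ENNReal.ofReal_ne_top]
  refine setLIntegral_mono' hΩ fun x hx => ?_
  rw [← ENNReal.ofReal_add (by positivity) (by positivity), ← ENNReal.ofReal_mul (by positivity)]
  exact ENNReal.ofReal_le_ofReal (norm_add_rpow_le (hp x hx) (hpb x hx) _ _)

theorem modular_le_liminf (hΩ : MeasurableSet Ω) (hp : ∀ x ∈ Ω, 0 < p x)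
    (hpm : AEMeasurable p (volume.restrict Ω)) {f : ℕ → EuclideanSpace ℝ (Fin N) → F}
    {g : EuclideanSpace ℝ (Fin N) → F} (hf : ∀ n, AEStronglyMeasurable (f n) (volume.restrict Ω))
    (hfg : ∀ᵐ x ∂volume.restrict Ω, Tendsto (fun n => f n x) atTop (𝓝 (g x))) :
    modular Ω p g ≤ liminf (fun n => modular Ω p (f n)) atTop := by
  refine le_trans ?_ (lintegral_liminf_le' fun n => aemeasurable_ofReal_norm_rpow hpm (hf n))
  refine lintegral_mono_ae ?_
  filter_upwards [hfg, ae_restrict_mem hΩ] with x hx hxΩ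
  exact (ENNReal.tendsto_ofReal
    (hx.norm.rpow tendsto_const_nhds (Or.inr (hp x hxΩ)))).liminf_eq.ge

variable [NormedSpace ℝ F]

theorem modular_smul_le_of_one_le {b c : ℝ} (hΩ : MeasurableSet Ω) (hpb : ∀ x ∈ Ω, p x ≤ b)
    (hc : 1 ≤ c) (f : EuclideanSpace ℝ (Fin N) → F) :
    modular Ω p (c • f) ≤ ENNReal.ofReal (c ^ b) * modular Ω p f := by
  have hc0 : 0 ≤ c := zero_le_one.trans hc
  unfold modular
  rw [← lintegral_const_mul' _ _ ENNReal.ofReal_ne_top]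
  refine setLIntegral_mono' hΩ fun x hx => ?_
  rw [← ENNReal.ofReal_mul (by positivity), Pi.smul_apply, norm_smul, Real.norm_of_nonneg hc0,
    Real.mul_rpow hc0 (norm_nonneg _)]
  gcongr
  exact hpb x hx

theorem modular_smul_le_of_le_one {c : ℝ} (hΩ : MeasurableSet Ω) (hp : ∀ x ∈ Ω, 1 ≤ p x)
    (hc0 : 0 ≤ c) (hc : c ≤ 1) (f : EuclideanSpace ℝ (Fin N) → F) :
    modular Ω p (c • f) ≤ ENNReal.ofReal c * modular Ω p f := by
  unfold modular
  rw [← lintegral_const_mul' _ _ ENNReal.ofReal_ne_top]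
  refine setLIntegral_mono' hΩ fun x hx => ?_
  rw [← ENNReal.ofReal_mul hc0, Pi.smul_apply, norm_smul, Real.norm_of_nonneg hc0,
    Real.mul_rpow hc0 (norm_nonneg _)]
  gcongr
  exact Real.rpow_le_self_of_le_one hc0 hc (hp x hx)

theorem tendsto_modular_const_smul {b : ℝ} (hΩ : MeasurableSet Ω) (hp : ∀ x ∈ Ω, 0 ≤ p x)
    (hpb : ∀ x ∈ Ω, p x ≤ b) {ι : Type*} {l : Filter ι} {f : ι → EuclideanSpace ℝ (Fin N) → F}
    (hf : Tendsto (fun i => modular Ω p (f i)) l (𝓝 0)) (c : ℝ) :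
    Tendsto (fun i => modular Ω p (c • f i)) l (𝓝 0) := by
  have hle (i : ι) : modular Ω p (c • f i) ≤
      ENNReal.ofReal (max |c| 1 ^ b) * modular Ω p (f i) := by
    refine (modular_mono_norm hΩ hp (g := max |c| 1 • f i) fun x _ => ?_).trans
      (modular_smul_le_of_one_le hΩ hpb (le_max_right _ _) (f i))
    rw [Pi.smul_apply, Pi.smul_apply, norm_smul, norm_smul, Real.norm_eq_abs, Real.norm_eq_abs]
    exact mul_le_mul_of_nonneg_right ((le_max_left _ _).trans (le_abs_self _)) (norm_nonneg _)
  refine tendsto_of_tendsto_of_tendsto_of_le_of_le tendsto_const_nhds ?_ (fun _ => zero_le) hle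
  simpa using ENNReal.Tendsto.const_mul hf (Or.inr ENNReal.ofReal_ne_top)

theorem modular_add_smul_le (hΩ : MeasurableSet Ω) (hp : ∀ x ∈ Ω, 1 ≤ p x)
    (hpm : AEMeasurable p (volume.restrict Ω)) {f : EuclideanSpace ℝ (Fin N) → F}
    (hf : AEStronglyMeasurable f (volume.restrict Ω)) (g : EuclideanSpace ℝ (Fin N) → F)
    {v w : ℝ} (hv : 0 ≤ v) (hw : 0 ≤ w) (hvw : v + w = 1) :
    modular Ω p (v • f + w • g) ≤
      ENNReal.ofReal v * modular Ω p f + ENNReal.ofReal w * modular Ω p g := by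
  unfold modular
  rw [← lintegral_const_mul' _ _ ENNReal.ofReal_ne_top,
    ← lintegral_const_mul' _ _ ENNReal.ofReal_ne_top,
    ← lintegral_add_left' ((aemeasurable_ofReal_norm_rpow hpm hf).const_mul _)]
  refine setLIntegral_mono' hΩ fun x hx => ?_
  rw [← ENNReal.ofReal_mul hv, ← ENNReal.ofReal_mul hw,
    ← ENNReal.ofReal_add (by positivity) (by positivity)]
  exact ENNReal.ofReal_le_ofReal ((convexOn_norm_rpow (hp x hx)).2 (Set.mem_univ (f x))
    (Set.mem_univ (g x)) hv hw hvw)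

theorem exists_modular_uniform_convexity [StrictConvexSpace ℝ F] [ProperSpace F] {a b : ℝ}
    (hΩ : MeasurableSet Ω) (ha : 1 < a) (hap : ∀ x ∈ Ω, a ≤ p x) (hpb : ∀ x ∈ Ω, p x ≤ b)
    (hpm : AEMeasurable p (volume.restrict Ω)) {ε : ℝ≥0} (hε : 0 < ε) :
    ∃ C : ℝ≥0, ∀ f g : EuclideanSpace ℝ (Fin N) → F,
      AEStronglyMeasurable f (volume.restrict Ω) → AEStronglyMeasurable g (volume.restrict Ω) →
      modular Ω p (f - g) + 2 * C * modular Ω p ((1 / 2 : ℝ) • (f + g)) ≤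
        (ε + C) * (modular Ω p f + modular Ω p g) := by
  obtain ⟨C, hC, h⟩ := exists_uniform_convexity (E := F) b ha (NNReal.coe_pos.2 hε)
  lift C to ℝ≥0 using hC
  refine ⟨C, fun f g hf hg => ?_⟩
  have htwo : (2 * C : ℝ≥0∞) = ENNReal.ofReal (2 * C) := by
    rw [ENNReal.ofReal_mul zero_le_two, ENNReal.ofReal_ofNat, ENNReal.ofReal_coe_nnreal]
  have hadd : (ε + C : ℝ≥0∞) = ENNReal.ofReal (ε + C) := by
    rw [ENNReal.ofReal_add ε.coe_nonneg C.coe_nonneg, ENNReal.ofReal_coe_nnreal,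
      ENNReal.ofReal_coe_nnreal]
  rw [htwo, hadd]
  unfold modular
  rw [← lintegral_const_mul' _ _ ENNReal.ofReal_ne_top,
    ← lintegral_add_left' (aemeasurable_ofReal_norm_rpow hpm (hf.sub hg)),
    ← lintegral_add_left' (aemeasurable_ofReal_norm_rpow hpm hf),
    ← lintegral_const_mul' _ _ ENNReal.ofReal_ne_top]
  refine setLIntegral_mono' hΩ fun x hx => ?_
  rw [← ENNReal.ofReal_mul (by positivity), ← ENNReal.ofReal_add (by positivity) (by positivity),
    ← ENNReal.ofReal_add (by positivity) (by positivity), ← ENNReal.ofReal_mul (by positivity)]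
  exact ENNReal.ofReal_le_ofReal (h (p x) ⟨hap x hx, hpb x hx⟩ (f x) (g x))

end Modular

section Luxemburg

variable {N : ℕ} {Ω : Set (EuclideanSpace ℝ (Fin N))} {p : EuclideanSpace ℝ (Fin N) → ℝ}
  {F : Type*} [NormedAddCommGroup F] [NormedSpace ℝ F]

theorem luxNorm_le_ofReal {f : EuclideanSpace ℝ (Fin N) → F} {γ : ℝ} (hγ : 0 < γ)
    (h : modular Ω p (γ⁻¹ • f) ≤ 1) : luxNorm Ω p f ≤ ENNReal.ofReal γ :=
  iInf_le_of_le γ (iInf_le_of_le hγ (iInf_le_of_le h le_rfl))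

theorem exists_modular_inv_smul_le_one {f : EuclideanSpace ℝ (Fin N) → F} {r : ℝ≥0∞}
    (h : luxNorm Ω p f < r) :
    ∃ γ : ℝ, 0 < γ ∧ ENNReal.ofReal γ < r ∧ modular Ω p (γ⁻¹ • f) ≤ 1 := by
  simp only [luxNorm, iInf_lt_iff] at h
  obtain ⟨γ, hγ, hmod, hlt⟩ := h
  exact ⟨γ, hγ, hlt, hmod⟩

theorem modular_inv_smul_le_one (hΩ : MeasurableSet Ω) (hp : ∀ x ∈ Ω, 0 ≤ p x)
    {f : EuclideanSpace ℝ (Fin N) → F} {r : ℝ} (h : luxNorm Ω p f < ENNReal.ofReal r) :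
    modular Ω p (r⁻¹ • f) ≤ 1 := by
  obtain ⟨γ, hγ, hγr, hmod⟩ := exists_modular_inv_smul_le_one h
  have hlt : γ < r := (ENNReal.ofReal_lt_ofReal_iff_of_nonneg hγ.le).1 hγr
  refine (modular_mono_norm hΩ hp fun x _ => ?_).trans hmod
  rw [Pi.smul_apply, Pi.smul_apply, norm_smul, norm_smul,
    Real.norm_of_nonneg (inv_nonneg.2 (hγ.trans hlt).le), Real.norm_of_nonneg (inv_nonneg.2 hγ.le)]
  gcongr

theorem luxNorm_add_le (hΩ : MeasurableSet Ω) (hp : ∀ x ∈ Ω, 1 ≤ p x)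
    (hpm : AEMeasurable p (volume.restrict Ω)) {f : EuclideanSpace ℝ (Fin N) → F}
    (hf : AEStronglyMeasurable f (volume.restrict Ω)) (g : EuclideanSpace ℝ (Fin N) → F) :
    luxNorm Ω p (f + g) ≤ luxNorm Ω p f + luxNorm Ω p g := by
  refine ENNReal.le_of_forall_pos_le_add fun ε hε hfin => ?_
  rw [ENNReal.add_lt_top] at hfin
  have hε2 : (ε / 2 : ℝ≥0∞) ≠ 0 := by simpa using hε.ne'
  obtain ⟨s, hs, hs', hfs⟩ := exists_modular_inv_smul_le_one (ENNReal.lt_add_right hfin.1.ne hε2)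
  obtain ⟨t, ht, ht', hgt⟩ := exists_modular_inv_smul_le_one (ENNReal.lt_add_right hfin.2.ne hε2)
  have hst : 0 < s + t := add_pos hs ht
  have hmod : modular Ω p ((s + t)⁻¹ • (f + g)) ≤ 1 := by
    have hconv := modular_add_smul_le hΩ hp hpm (hf.const_smul s⁻¹) (t⁻¹ • g)
      (div_nonneg hs.le hst.le) (div_nonneg ht.le hst.le) (by field_simp)
    calc modular Ω p ((s + t)⁻¹ • (f + g))
        = modular Ω p ((s / (s + t)) • s⁻¹ • f + (t / (s + t)) • t⁻¹ • g) := by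
          rw [smul_smul, smul_smul, smul_add]
          congr 3 <;> field_simp
      _ ≤ ENNReal.ofReal (s / (s + t)) * 1 + ENNReal.ofReal (t / (s + t)) * 1 :=
          hconv.trans (by gcongr)
      _ = 1 := by
          rw [mul_one, mul_one, ← ENNReal.ofReal_add (by positivity) (by positivity), ← add_div,
            div_self hst.ne', ENNReal.ofReal_one]
  calc luxNorm Ω p (f + g) ≤ ENNReal.ofReal (s + t) := luxNorm_le_ofReal hst hmod
    _ = ENNReal.ofReal s + ENNReal.ofReal t := ENNReal.ofReal_add hs.le ht.le
    _ ≤ (luxNorm Ω p f + ε / 2) + (luxNorm Ω p g + ε / 2) := add_le_add hs'.le ht'.le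
    _ = luxNorm Ω p f + luxNorm Ω p g + ε := by rw [add_add_add_comm, ENNReal.add_halves]

theorem luxNorm_sub_comm (f g : EuclideanSpace ℝ (Fin N) → F) :
    luxNorm Ω p (f - g) = luxNorm Ω p (g - f) := by
  simp only [luxNorm, modular, Pi.sub_apply, norm_smul, norm_sub_rev]

theorem eLpNorm_one_le_luxNorm (hΩ : MeasurableSet Ω) (hΩ' : volume Ω ≠ ⊤)
    (hp : ∀ x ∈ Ω, 1 ≤ p x) (f : EuclideanSpace ℝ (Fin N) → F) :
    eLpNorm f 1 (volume.restrict Ω) ≤ (volume Ω + 1) * luxNorm Ω p f := by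
  rw [← ENNReal.div_le_iff' (by simp) (by simpa using hΩ')]
  refine le_iInf₂ fun γ hγ => le_iInf fun hmod => ?_
  rw [ENNReal.div_le_iff' (by simp) (by simpa using hΩ')]
  calc eLpNorm f 1 (volume.restrict Ω)
      = ENNReal.ofReal γ * eLpNorm (γ⁻¹ • f) 1 (volume.restrict Ω) := by
        rw [← Real.enorm_of_nonneg hγ.le, ← eLpNorm_const_smul, smul_inv_smul₀ hγ.ne']
    _ ≤ ENNReal.ofReal γ * (volume Ω + 1) := by
        rw [← modular_one]
        gcongr
        exact (modular_le_measure_add hΩ (fun _ _ => zero_le_one) hp _).trans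
          (add_le_add_right hmod _)
    _ = (volume Ω + 1) * ENNReal.ofReal γ := mul_comm _ _

theorem tendsto_luxNorm_of_tendsto_modular {b : ℝ} (hΩ : MeasurableSet Ω)
    (hp : ∀ x ∈ Ω, 0 ≤ p x) (hpb : ∀ x ∈ Ω, p x ≤ b) {ι : Type*} {l : Filter ι}
    {f : ι → EuclideanSpace ℝ (Fin N) → F}
    (hf : Tendsto (fun i => modular Ω p (f i)) l (𝓝 0)) :
    Tendsto (fun i => luxNorm Ω p (f i)) l (𝓝 0) := by
  refine ENNReal.tendsto_nhds_zero.2 fun ε hε => ?_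
  obtain ⟨γ, hγ, hγε⟩ := ENNReal.lt_iff_exists_nnreal_btwn.1 hε
  have hγ0 : (0 : ℝ) < γ := by exact_mod_cast hγ
  filter_upwards [(tendsto_modular_const_smul hΩ hp hpb hf (γ : ℝ)⁻¹).eventually_le_const one_pos]
    with i hi
  exact (luxNorm_le_ofReal hγ0 hi).trans (by simpa using hγε.le)

theorem tendsto_eLpNorm_one_of_tendsto_modular {b : ℝ} (hΩ : MeasurableSet Ω)
    (hΩ' : volume Ω ≠ ⊤) (hp : ∀ x ∈ Ω, 1 ≤ p x) (hpb : ∀ x ∈ Ω, p x ≤ b) {ι : Type*}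
    {l : Filter ι} {f : ι → EuclideanSpace ℝ (Fin N) → F}
    (hf : Tendsto (fun i => modular Ω p (f i)) l (𝓝 0)) :
    Tendsto (fun i => eLpNorm (f i) 1 (volume.restrict Ω)) l (𝓝 0) := by
  refine tendsto_of_tendsto_of_tendsto_of_le_of_le tendsto_const_nhds ?_ (fun _ => zero_le)
    fun i => eLpNorm_one_le_luxNorm hΩ hΩ' hp (f i)
  have hp0 : ∀ x ∈ Ω, 0 ≤ p x := fun x hx => zero_le_one.trans (hp x hx)
  simpa using ENNReal.Tendsto.const_mul (tendsto_luxNorm_of_tendsto_modular hΩ hp0 hpb hf)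
    (Or.inr (by simpa using hΩ'))

end Luxemburg

section Gradient

variable {E : Type*} [NormedAddCommGroup E] [InnerProductSpace ℝ E] [CompleteSpace E]
  {φ ψ : E → ℝ}

theorem gradient_add (hφ : Differentiable ℝ φ) (hψ : Differentiable ℝ ψ) :
    gradient (φ + ψ) = gradient φ + gradient ψ := by
  ext1 x
  simp only [gradient, fderiv_add (hφ x) (hψ x), map_add, Pi.add_apply]

theorem gradient_sub (hφ : Differentiable ℝ φ) (hψ : Differentiable ℝ ψ) :
    gradient (φ - ψ) = gradient φ - gradient ψ := by
  ext1 x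
  simp only [gradient, fderiv_sub (hφ x) (hψ x), map_sub, Pi.sub_apply]

theorem gradient_const_smul (c : ℝ) (φ : E → ℝ) : gradient (c • φ) = c • gradient φ := by
  ext1 x
  simp [gradient, fderiv_const_smul_field]

theorem norm_gradient (φ : E → ℝ) (x : E) : ‖gradient φ x‖ = ‖fderiv ℝ φ x‖ :=
  LinearIsometryEquiv.norm_map _ _

theorem continuous_gradient (hφ : ContDiff ℝ 1 φ) : Continuous (gradient φ) :=
  (LinearIsometryEquiv.continuous _).comp (hφ.continuous_fderiv one_ne_zero)

end Gradient

section TestFunction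

variable {N : ℕ} {Ω : Set (EuclideanSpace ℝ (Fin N))} {φ ψ : EuclideanSpace ℝ (Fin N) → ℝ}

namespace IsTestFunction

theorem contDiff_one (hφ : IsTestFunction Ω φ) : ContDiff ℝ 1 φ :=
  hφ.1.of_le (by exact_mod_cast le_top)

theorem differentiable (hφ : IsTestFunction Ω φ) : Differentiable ℝ φ :=
  hφ.contDiff_one.differentiable one_ne_zero

theorem add (hφ : IsTestFunction Ω φ) (hψ : IsTestFunction Ω ψ) : IsTestFunction Ω (φ + ψ) :=
  ⟨hφ.1.add hψ.1, hφ.2.1.add hψ.2.1,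
    (tsupport_add φ ψ).trans (Set.union_subset hφ.2.2 hψ.2.2)⟩

theorem sub (hφ : IsTestFunction Ω φ) (hψ : IsTestFunction Ω ψ) : IsTestFunction Ω (φ - ψ) :=
  ⟨hφ.1.sub hψ.1, hφ.2.1.sub hψ.2.1,
    (tsupport_sub φ ψ).trans (Set.union_subset hφ.2.2 hψ.2.2)⟩

theorem const_smul (hφ : IsTestFunction Ω φ) (c : ℝ) : IsTestFunction Ω (c • φ) :=
  ⟨hφ.1.const_smul c, hφ.2.1.smul_left,
    (tsupport_smul_subset_right (fun _ => c) φ).trans hφ.2.2⟩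

theorem integrable (hφ : IsTestFunction Ω φ) : Integrable φ :=
  hφ.1.continuous.integrable_of_hasCompactSupport hφ.2.1

theorem aestronglyMeasurable (hφ : IsTestFunction Ω φ) {μ : Measure (EuclideanSpace ℝ (Fin N))} :
    AEStronglyMeasurable φ μ :=
  hφ.1.continuous.aestronglyMeasurable

theorem aestronglyMeasurable_gradient (hφ : IsTestFunction Ω φ)
    {μ : Measure (EuclideanSpace ℝ (Fin N))} : AEStronglyMeasurable (gradient φ) μ :=
  (continuous_gradient hφ.contDiff_one).aestronglyMeasurable

theorem hasCompactSupport_gradient (hφ : IsTestFunction Ω φ) : HasCompactSupport (gradient φ) :=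
  (hφ.2.1.fderiv ℝ).comp_left (map_zero _)

theorem integrable_gradient (hφ : IsTestFunction Ω φ) : Integrable (gradient φ) :=
  (continuous_gradient hφ.contDiff_one).integrable_of_hasCompactSupport
    hφ.hasCompactSupport_gradient

end IsTestFunction

end TestFunction

section Sobolev

theorem inv_le_inv_add_inv_of_one_le {r : ℝ≥0} (hr : 1 ≤ r) (c : ℝ≥0) : r⁻¹ ≤ (r + c)⁻¹ + c := by
  have hr0 : r ≠ 0 := (one_pos.trans_le hr).ne'
  have hrc : r + c ≠ 0 := (one_pos.trans_le (hr.trans (le_add_of_nonneg_right zero_le))).ne'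
  calc r⁻¹ = (r + c)⁻¹ + c * (r⁻¹ * (r + c)⁻¹) := by field_simp
    _ ≤ (r + c)⁻¹ + c := by
        gcongr
        exact mul_le_of_le_one_right zero_le (mul_le_one₀ (inv_le_one_of_one_le₀ hr) zero_le
          (inv_le_one_of_one_le₀ (hr.trans (le_add_of_nonneg_right zero_le))))

theorem exists_subcritical_exponent {n : ℕ} (hn : 2 ≤ n) {q r : ℝ≥0} (hq : 1 ≤ q) (hr : r ≠ 0)
    (hqr : q⁻¹ ≤ r⁻¹ + (n : ℝ≥0)⁻¹) :
    ∃ s : ℝ≥0, 1 ≤ s ∧ s ≤ q ∧ s < n ∧ (s : ℝ)⁻¹ - (n : ℝ)⁻¹ ≤ (r : ℝ)⁻¹ := by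
  have hn1 : (1 : ℝ≥0) < n := by exact_mod_cast hn
  set t : ℝ≥0 := min 1 (r⁻¹ + (n : ℝ≥0)⁻¹)
  have hnt : (n : ℝ≥0)⁻¹ < t :=
    lt_min (inv_lt_one_of_one_lt₀ hn1) (lt_add_of_pos_left _ (by positivity))
  have ht0 : 0 < t := zero_le.trans_lt hnt
  refine ⟨t⁻¹, (one_le_inv₀ ht0).2 (min_le_left _ _),
    inv_le_of_inv_le₀ (one_pos.trans_le hq) (le_min (inv_le_one_of_one_le₀ hq) hqr),
    inv_lt_of_inv_lt₀ (one_pos.trans hn1) hnt, ?_⟩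
  rw [NNReal.coe_inv, inv_inv, sub_le_iff_le_add]
  exact_mod_cast min_le_right (1 : ℝ≥0) (r⁻¹ + (n : ℝ≥0)⁻¹)

theorem eLpNorm_le_eLpNorm_mul_rpow_of_support_subset {α F : Type*} [MeasurableSpace α]
    [NormedAddCommGroup F] {μ : Measure α} {f : α → F} {s : Set α} (hfs : Function.support f ⊆ s)
    (hf : AEStronglyMeasurable f μ) {p q : ℝ≥0∞} (hpq : p ≤ q) :
    eLpNorm f p μ ≤ eLpNorm f q μ * μ s ^ (1 / p.toReal - 1 / q.toReal) := by
  rw [← eLpNorm_restrict_eq_of_support_subset hfs, ← Measure.restrict_apply_univ s]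
  exact (eLpNorm_le_eLpNorm_mul_rpow_measure_univ hpq hf.restrict).trans
    (by gcongr; exact Measure.restrict_le_self)

theorem exists_cutoff {E : Type*} [NormedAddCommGroup E] [NormedSpace ℝ E]
    [FiniteDimensional ℝ E] (x₀ : E) {ρ R : ℝ} (hρ : 0 < ρ) (hρR : ρ < R) :
    ∃ (η : E → ℝ) (D : ℝ), ContDiff ℝ 1 η ∧ (∀ x, ‖η x‖ ≤ 1) ∧ (∀ x, ‖fderiv ℝ η x‖ ≤ D) ∧
      (∀ x ∈ Metric.ball x₀ ρ, η x = 1) ∧ tsupport η ⊆ Metric.ball x₀ R := by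
  obtain ⟨σ, hρσ, hσR⟩ := exists_between hρR
  let η : ContDiffBump x₀ := ⟨ρ, σ, hρ, hρσ⟩
  obtain ⟨D, hD⟩ := (η.hasCompactSupport.fderiv ℝ).exists_bound_of_continuous
    (η.contDiff (n := 1) |>.continuous_fderiv one_ne_zero)
  refine ⟨η, D, η.contDiff, fun x => ?_, hD, fun x hx => ?_, ?_⟩
  · rw [Real.norm_of_nonneg η.nonneg]
    exact η.le_one
  · exact η.one_of_mem_closedBall (Metric.ball_subset_closedBall hx)
  · rw [η.tsupport_eq]
    exact Metric.closedBall_subset_ball hσR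

variable {E F : Type*} [NormedAddCommGroup E] [NormedSpace ℝ E] [FiniteDimensional ℝ E]
  [MeasurableSpace E] [BorelSpace E] [NormedAddCommGroup F] [NormedSpace ℝ F]

theorem exists_eLpNorm_le_eLpNorm_fderiv [FiniteDimensional ℝ F] (μ : Measure E)
    [μ.IsAddHaarMeasure] (hn : 2 ≤ Module.finrank ℝ E) {s : Set E} (hs : Bornology.IsBounded s)
    {q r : ℝ≥0} (hq : 1 ≤ q) (hr : r ≠ 0) (hqr : q⁻¹ ≤ r⁻¹ + (Module.finrank ℝ E : ℝ≥0)⁻¹) :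
    ∃ C : ℝ≥0, ∀ g : E → F, ContDiff ℝ 1 g → Function.support g ⊆ s →
      eLpNorm g r μ ≤ C * eLpNorm (fderiv ℝ g) q μ := by
  obtain ⟨t, ht1, htq, htn, htr⟩ := exists_subcritical_exponent hn hq hr hqr
  have hfin : μ (closure s) ^ (1 / (t : ℝ≥0∞).toReal - 1 / (q : ℝ≥0∞).toReal) ≠ ⊤ :=
    ENNReal.rpow_ne_top_of_nonneg (sub_nonneg.2 (one_div_le_one_div_of_le
      (NNReal.coe_pos.2 (one_pos.trans_le ht1)) htq)) hs.isCompact_closure.measure_lt_top.ne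
  lift μ (closure s) ^ (1 / (t : ℝ≥0∞).toReal - 1 / (q : ℝ≥0∞).toReal) to ℝ≥0 using hfin with V hV
  refine ⟨eLpNormLESNormFDerivOfLeConst F μ s t r * V, fun g hg hgs => ?_⟩
  have hholder : eLpNorm (fderiv ℝ g) t μ ≤ eLpNorm (fderiv ℝ g) q μ * V := hV ▸
    eLpNorm_le_eLpNorm_mul_rpow_of_support_subset
      ((support_fderiv_subset ℝ).trans (closure_mono hgs))
      (hg.continuous_fderiv one_ne_zero).aestronglyMeasurable (by exact_mod_cast htq)
  calc eLpNorm g r μ ≤ eLpNormLESNormFDerivOfLeConst F μ s t r * eLpNorm (fderiv ℝ g) t μ :=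
        eLpNorm_le_eLpNorm_fderiv_of_le μ hg hgs ht1 htn htr hs
    _ ≤ eLpNormLESNormFDerivOfLeConst F μ s t r * (eLpNorm (fderiv ℝ g) q μ * V) := by gcongr
    _ = ↑(eLpNormLESNormFDerivOfLeConst F μ s t r * V) * eLpNorm (fderiv ℝ g) q μ := by
        rw [ENNReal.coe_mul, mul_assoc, mul_comm (V : ℝ≥0∞)]

theorem eLpNorm_fderiv_mul_le {η φ : E → ℝ} (hη : ContDiff ℝ 1 η) (hφ : ContDiff ℝ 1 φ)
    (hη1 : ∀ x, ‖η x‖ ≤ 1) {D : ℝ} (hD : ∀ x, ‖fderiv ℝ η x‖ ≤ D) {B : Set E}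
    (hB : tsupport (η * φ) ⊆ B) (μ : Measure E) {q : ℝ≥0∞} (hq : 1 ≤ q) :
    eLpNorm (fderiv ℝ (η * φ)) q μ ≤
      eLpNorm (fderiv ℝ φ) q (μ.restrict B) + ENNReal.ofReal D * eLpNorm φ q (μ.restrict B) := by
  have hderiv : fderiv ℝ (η * φ) = η • fderiv ℝ φ + φ • fderiv ℝ η :=
    funext fun x => fderiv_mul (hη.differentiable one_ne_zero x) (hφ.differentiable one_ne_zero x)
  rw [← eLpNorm_restrict_eq_of_support_subset (f := fderiv ℝ (η * φ))
    ((support_fderiv_subset ℝ).trans hB), hderiv]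
  refine (eLpNorm_add_le
    (hη.continuous.smul (hφ.continuous_fderiv one_ne_zero)).aestronglyMeasurable
    (hφ.continuous.smul (hη.continuous_fderiv one_ne_zero)).aestronglyMeasurable hq).trans
    (add_le_add (eLpNorm_mono fun x => ?_)
      (eLpNorm_le_mul_eLpNorm_of_ae_le_mul (.of_forall fun x => ?_) q))
  · rw [Pi.smul_apply', norm_smul]
    exact mul_le_of_le_one_left (norm_nonneg _) (hη1 x)
  · rw [Pi.smul_apply', norm_smul, mul_comm]
    exact mul_le_mul_of_nonneg_right (hD x) (norm_nonneg _)

theorem exists_eLpNorm_ball_le_of_tsupport_subset (μ : Measure E) [μ.IsAddHaarMeasure]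
    (hn : 2 ≤ Module.finrank ℝ E) (x₀ : E) {ρ R : ℝ} (hρ : 0 < ρ) (hρR : ρ < R) {q r : ℝ≥0}
    (hq : 1 ≤ q) (hr : r ≠ 0) (hqr : q⁻¹ ≤ r⁻¹ + (Module.finrank ℝ E : ℝ≥0)⁻¹) :
    ∃ (C : ℝ≥0) (D : ℝ), ∀ (Ω : Set E) (φ : E → ℝ), ContDiff ℝ 1 φ → tsupport φ ⊆ Ω →
      eLpNorm φ r (μ.restrict (Metric.ball x₀ ρ)) ≤
        C * (eLpNorm (fderiv ℝ φ) q (μ.restrict (Ω ∩ Metric.ball x₀ R)) +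
          ENNReal.ofReal D * eLpNorm φ q (μ.restrict (Ω ∩ Metric.ball x₀ R))) := by
  obtain ⟨C, hC⟩ := exists_eLpNorm_le_eLpNorm_fderiv (F := ℝ) μ hn
    (Metric.isBounded_ball (x := x₀) (r := R)) hq hr hqr
  obtain ⟨η, D, hη, hη1, hD, hηρ, hηR⟩ := exists_cutoff x₀ hρ hρR
  refine ⟨C, D, fun Ω φ hφ hφΩ => ?_⟩
  have hηφR : tsupport (η * φ) ⊆ Metric.ball x₀ R := tsupport_mul_subset_left.trans hηR
  have hηφ : tsupport (η * φ) ⊆ Ω ∩ Metric.ball x₀ R :=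
    Set.subset_inter (tsupport_mul_subset_right.trans hφΩ) hηφR
  have heq : φ =ᵐ[μ.restrict (Metric.ball x₀ ρ)] η * φ := by
    filter_upwards [ae_restrict_mem measurableSet_ball] with x hx
    rw [Pi.mul_apply, hηρ x hx, one_mul]
  calc eLpNorm φ r (μ.restrict (Metric.ball x₀ ρ))
      = eLpNorm (η * φ) r (μ.restrict (Metric.ball x₀ ρ)) := eLpNorm_congr_ae heq
    _ ≤ eLpNorm (η * φ) r μ := eLpNorm_restrict_le _ _ _ _
    _ ≤ C * eLpNorm (fderiv ℝ (η * φ)) q μ :=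
        hC _ (hη.mul hφ) ((subset_tsupport _).trans hηφR)
    _ ≤ C * (eLpNorm (fderiv ℝ φ) q (μ.restrict (Ω ∩ Metric.ball x₀ R)) +
          ENNReal.ofReal D * eLpNorm φ q (μ.restrict (Ω ∩ Metric.ball x₀ R))) := by
        gcongr
        exact eLpNorm_fderiv_mul_le hη hφ hη1 hD hηφ μ (by exact_mod_cast hq)

end Sobolev

section ModularSobolev

variable {N : ℕ} {Ω t t' : Set (EuclideanSpace ℝ (Fin N))} {p q q' : EuclideanSpace ℝ (Fin N) → ℝ}

/-- The modular form of a Sobolev inequality: on the unit modular ball of gradients of test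
functions of `Ω`, the `q(x)`-modular over `t` is bounded. The set `t` is kept separate from `Ω` so
that the inequality can be localised. -/
def ModularSobolev (Ω : Set (EuclideanSpace ℝ (Fin N))) (p q : EuclideanSpace ℝ (Fin N) → ℝ)
    (t : Set (EuclideanSpace ℝ (Fin N))) : Prop :=
  ∃ C : ℝ≥0, ∀ φ : EuclideanSpace ℝ (Fin N) → ℝ, IsTestFunction Ω φ →
    modular Ω p (gradient φ) ≤ 1 → modular t q φ ≤ C

namespace ModularSobolev

theorem mono_set (h : ModularSobolev Ω p q t) (htt' : t' ⊆ t) : ModularSobolev Ω p q t' :=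
  h.imp fun _ hC φ hφ hgrad => (lintegral_mono_set htt').trans (hC φ hφ hgrad)

theorem union (h : ModularSobolev Ω p q t) (h' : ModularSobolev Ω p q t') :
    ModularSobolev Ω p q (t ∪ t') := by
  obtain ⟨C, hC⟩ := h
  obtain ⟨C', hC'⟩ := h'
  refine ⟨C + C', fun φ hφ hgrad => (lintegral_union_le _ _ _).trans ?_⟩
  rw [ENNReal.coe_add]
  exact add_le_add (hC φ hφ hgrad) (hC' φ hφ hgrad)

theorem mono_exponent (h : ModularSobolev Ω p q t) (ht : MeasurableSet t) (ht' : volume t ≠ ⊤)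
    (hq : ∀ x ∈ t, 0 ≤ q' x) (hqq' : ∀ x ∈ t, q' x ≤ q x) : ModularSobolev Ω p q' t := by
  obtain ⟨C, hC⟩ := h
  refine ⟨(volume t).toNNReal + C, fun φ hφ hgrad => ?_⟩
  rw [ENNReal.coe_add, ENNReal.coe_toNNReal ht']
  exact (modular_le_measure_add ht hq hqq' φ).trans (by gcongr; exact hC φ hφ hgrad)

end ModularSobolev

theorem eLpNorm_fderiv_le_of_modular_gradient_le_one
    {B : Set (EuclideanSpace ℝ (Fin N))} (hB : MeasurableSet B) {r : ℝ≥0} (hr : r ≠ 0)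
    (hrp : ∀ x ∈ B, r ≤ p x) {φ : EuclideanSpace ℝ (Fin N) → ℝ}
    (h : modular B p (gradient φ) ≤ 1) :
    eLpNorm (fderiv ℝ φ) r (volume.restrict B) ≤ (volume B + 1) ^ (r : ℝ)⁻¹ := by
  rw [ENNReal.le_rpow_inv_iff (by positivity), ← modular_const hr]
  calc modular B (fun _ => (r : ℝ)) (fderiv ℝ φ)
      ≤ modular B (fun _ => (r : ℝ)) (gradient φ) :=
        modular_mono_norm hB (fun _ _ => r.coe_nonneg) fun x _ => (norm_gradient φ x).ge
    _ ≤ volume B + modular B p (gradient φ) :=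
        modular_le_measure_add hB (fun _ _ => r.coe_nonneg) hrp _
    _ ≤ volume B + 1 := by gcongr

theorem modularSobolev_one (hN : 2 ≤ N) (hΩ : MeasurableSet Ω) (hbdd : Bornology.IsBounded Ω)
    (hp : ∀ x ∈ Ω, 1 ≤ p x) : ModularSobolev Ω p (fun _ => 1) Ω := by
  obtain ⟨C, hC⟩ := exists_eLpNorm_le_eLpNorm_fderiv (F := ℝ)
    (volume : Measure (EuclideanSpace ℝ (Fin N))) (by simpa using hN) hbdd le_rfl one_ne_zero
    (q := 1) (by simp)
  refine ⟨C * ((volume Ω).toNNReal + 1), fun φ hφ hgrad => ?_⟩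
  have hfderiv : eLpNorm (fderiv ℝ φ) 1 (volume.restrict Ω) ≤ volume Ω + 1 := by
    simpa using eLpNorm_fderiv_le_of_modular_gradient_le_one hΩ (r := 1) one_ne_zero
      (by simpa using hp) hgrad
  rw [ENNReal.coe_mul, ENNReal.coe_add, ENNReal.coe_toNNReal hbdd.measure_lt_top.ne, modular_one]
  calc eLpNorm φ 1 (volume.restrict Ω) ≤ eLpNorm φ 1 volume := eLpNorm_restrict_le _ _ _ _
    _ ≤ C * eLpNorm (fderiv ℝ φ) 1 volume := by
        simpa using hC φ hφ.contDiff_one ((subset_tsupport φ).trans hφ.2.2)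
    _ = C * eLpNorm (fderiv ℝ φ) 1 (volume.restrict Ω) := by
        rw [eLpNorm_restrict_eq_of_support_subset (f := fderiv ℝ φ)
          ((support_fderiv_subset ℝ).trans hφ.2.2)]
    _ ≤ C * (volume Ω + 1) := by gcongr

theorem ModularSobolev.gain_on_smaller_ball (hN : 2 ≤ N) (hΩ : MeasurableSet Ω)
    {x₀ : EuclideanSpace ℝ (Fin N)} {ρ R : ℝ} (hρ : 0 < ρ) (hρR : ρ < R) {r s : ℝ≥0}
    (hr : 1 ≤ r) (hs : s ≠ 0) (hrs : r⁻¹ ≤ s⁻¹ + (N : ℝ≥0)⁻¹)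
    (hrp : ∀ x ∈ Ω ∩ Metric.ball x₀ R, r ≤ p x)
    (h : ModularSobolev Ω p (fun _ => r) (Ω ∩ Metric.ball x₀ R)) :
    ModularSobolev Ω p (fun _ => s) (Ω ∩ Metric.ball x₀ ρ) := by
  obtain ⟨C, hC⟩ := h
  obtain ⟨K, D, hK⟩ := exists_eLpNorm_ball_le_of_tsupport_subset
    (volume : Measure (EuclideanSpace ℝ (Fin N))) (by simpa using hN) x₀ hρ hρR hr hs
    (by simpa using hrs)
  set B := Ω ∩ Metric.ball x₀ R
  have hB : volume B ≠ ⊤ :=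
    ((measure_mono Set.inter_subset_right).trans_lt measure_ball_lt_top).ne
  have hr0 : r ≠ 0 := (one_pos.trans_le hr).ne'
  set M : ℝ≥0∞ := (K * ((volume B + 1) ^ (r : ℝ)⁻¹ + ENNReal.ofReal D * C ^ (r : ℝ)⁻¹)) ^ (s : ℝ)
    with hM_def
  have hM : M ≠ ⊤ := by finiteness
  refine ⟨M.toNNReal, fun φ hφ hgrad => ?_⟩
  have hφB : eLpNorm φ r (volume.restrict B) ≤ C ^ (r : ℝ)⁻¹ := by
    rw [ENNReal.le_rpow_inv_iff (by positivity), ← modular_const hr0]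
    exact hC φ hφ hgrad
  have hfderiv : eLpNorm (fderiv ℝ φ) r (volume.restrict B) ≤ (volume B + 1) ^ (r : ℝ)⁻¹ :=
    eLpNorm_fderiv_le_of_modular_gradient_le_one (hΩ.inter measurableSet_ball) hr0 hrp
      ((lintegral_mono_set Set.inter_subset_left).trans hgrad)
  rw [modular_const hs, ENNReal.coe_toNNReal hM, hM_def]
  gcongr
  calc eLpNorm φ s (volume.restrict (Ω ∩ Metric.ball x₀ ρ))
      ≤ eLpNorm φ s (volume.restrict (Metric.ball x₀ ρ)) :=
        eLpNorm_mono_measure _ (Measure.restrict_mono_set _ Set.inter_subset_right)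
    _ ≤ K * (eLpNorm (fderiv ℝ φ) r (volume.restrict B) +
          ENNReal.ofReal D * eLpNorm φ r (volume.restrict B)) := hK Ω φ hφ.contDiff_one hφ.2.2
    _ ≤ K * ((volume B + 1) ^ (r : ℝ)⁻¹ + ENNReal.ofReal D * C ^ (r : ℝ)⁻¹) := by gcongr

theorem ModularSobolev.gain_near_point (hN : 2 ≤ N) (hΩ : MeasurableSet Ω)
    (hbdd : Bornology.IsBounded Ω) (hp : ∀ x ∈ Ω, 1 ≤ p x) {x₀ : EuclideanSpace ℝ (Fin N)}
    (hcont : ContinuousWithinAt p (closure Ω) x₀) {s : ℝ} (hs : 1 ≤ s)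
    (h : ModularSobolev Ω p (fun x => min (p x) s) Ω) :
    ∃ ρ > 0, ModularSobolev Ω p (fun x => min (p x) (s + 1 / N)) (Ω ∩ Metric.ball x₀ ρ) := by
  obtain ⟨R, hR, hclose⟩ := Metric.continuousWithinAt_iff.1 hcont (1 / (2 * N)) (by positivity)
  have hosc : ∀ x ∈ Ω ∩ Metric.ball x₀ R, |p x - p x₀| < 1 / (2 * N) := fun x hx => by
    simpa [Real.dist_eq] using hclose (subset_closure hx.1) hx.2
  have hhalf : 1 / (2 * (N : ℝ)) + 1 / (2 * N) = 1 / N := by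
    have : (N : ℝ) ≠ 0 := by positivity
    field_simp
    norm_num
  have hfin {ρ : ℝ} : volume (Ω ∩ Metric.ball x₀ ρ) ≠ ⊤ :=
    (hbdd.subset Set.inter_subset_left).measure_lt_top.ne
  set P : ℝ := max 1 (p x₀ - 1 / (2 * N))
  have hPp : ∀ x ∈ Ω ∩ Metric.ball x₀ R, P ≤ p x := fun x hx =>
    max_le (hp x hx.1) (by linarith [(abs_lt.1 (hosc x hx)).1])
  have hpP : ∀ x ∈ Ω ∩ Metric.ball x₀ R, p x ≤ P + 1 / N := fun x hx => by
    linarith [(abs_lt.1 (hosc x hx)).2, le_max_right 1 (p x₀ - 1 / (2 * N))]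
  obtain ⟨r, hr⟩ : ∃ r : ℝ≥0, (r : ℝ) = min P s :=
    ⟨⟨min P s, by positivity⟩, rfl⟩
  have hr1 : 1 ≤ r := by
    rw [← NNReal.coe_le_coe, hr]
    exact le_min (le_max_left _ _) hs
  have hPs : ModularSobolev Ω p (fun _ => r) (Ω ∩ Metric.ball x₀ R) :=
    (h.mono_set Set.inter_subset_left).mono_exponent (hΩ.inter measurableSet_ball) hfin
      (fun _ _ => r.coe_nonneg) fun x hx => hr ▸ min_le_min_right s (hPp x hx)
  have hgain := hPs.gain_on_smaller_ball hN hΩ (half_pos hR) (half_lt_self hR) hr1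
    (s := r + (N : ℝ≥0)⁻¹) (one_pos.trans_le (hr1.trans (le_add_of_nonneg_right zero_le))).ne'
    (inv_le_inv_add_inv_of_one_le hr1 _) fun x hx => hr ▸ (min_le_left _ _).trans (hPp x hx)
  refine ⟨R / 2, half_pos hR, hgain.mono_exponent (hΩ.inter measurableSet_ball) hfin
    (fun x hx => le_min (zero_le_one.trans (hp x hx.1)) (by positivity)) fun x hx => ?_⟩
  have hxR : x ∈ Ω ∩ Metric.ball x₀ R := ⟨hx.1, Metric.ball_subset_ball (by linarith) hx.2⟩
  calc min (p x) (s + 1 / N) ≤ min (P + 1 / N) (s + 1 / N) := min_le_min_right _ (hpP x hxR)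
    _ = ↑(r + (N : ℝ≥0)⁻¹) := by push_cast; rw [hr, min_add_add_right, one_div]

theorem ModularSobolev.gain (hN : 2 ≤ N) (hΩ : MeasurableSet Ω) (hbdd : Bornology.IsBounded Ω)
    (hp : ∀ x ∈ Ω, 1 ≤ p x) (hcont : ContinuousOn p (closure Ω)) {s : ℝ} (hs : 1 ≤ s)
    (h : ModularSobolev Ω p (fun x => min (p x) s) Ω) :
    ModularSobolev Ω p (fun x => min (p x) (s + 1 / N)) Ω := by
  suffices ModularSobolev Ω p (fun x => min (p x) (s + 1 / N)) (Ω ∩ closure Ω) from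
    this.mono_set (Set.subset_inter subset_rfl subset_closure)
  refine hbdd.isCompact_closure.induction_on
    (p := fun t => ModularSobolev Ω p (fun x => min (p x) (s + 1 / N)) (Ω ∩ t)) ?_ ?_ ?_ ?_
  · exact ⟨0, fun φ _ _ => by simp [modular]⟩
  · exact fun t t' htt' ht' => ht'.mono_set (Set.inter_subset_inter_right _ htt')
  · exact fun t t' ht ht' => Set.inter_union_distrib_left Ω t t' ▸ ht.union ht'
  · intro x₀ hx₀
    obtain ⟨ρ, hρ, hball⟩ := h.gain_near_point hN hΩ hbdd hp (hcont x₀ hx₀) hs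
    exact ⟨_, mem_nhdsWithin_of_mem_nhds (Metric.ball_mem_nhds x₀ hρ), hball⟩

theorem modularSobolev_self (hN : 2 ≤ N) (hΩ : MeasurableSet Ω) (hbdd : Bornology.IsBounded Ω)
    (hp : ∀ x ∈ Ω, 1 ≤ p x) (hcont : ContinuousOn p (closure Ω)) : ModularSobolev Ω p p Ω := by
  have hp0 : ∀ x ∈ Ω, 0 ≤ p x := fun x hx => zero_le_one.trans (hp x hx)
  have hfin : volume Ω ≠ ⊤ := hbdd.measure_lt_top.ne
  have hiter (k : ℕ) : ModularSobolev Ω p (fun x => min (p x) (1 + k * (1 / N))) Ω := by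
    induction k with
    | zero =>
      exact (modularSobolev_one hN hΩ hbdd hp).mono_exponent hΩ hfin
        (fun x hx => le_min (hp0 x hx) (by simp)) fun x _ => by simp
    | succ k ih =>
      simpa only [Nat.cast_succ, add_mul, one_mul, add_assoc] using
        ih.gain hN hΩ hbdd hp hcont (le_add_of_nonneg_right (by positivity))
  obtain ⟨b, hb⟩ := hbdd.isCompact_closure.bddAbove_image hcont
  obtain ⟨k, hk⟩ := exists_nat_ge (b * N)
  refine (hiter k).mono_exponent hΩ hfin hp0 fun x hx => le_min le_rfl ?_
  have hbk : b ≤ k * (1 / N) := by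
    rw [mul_one_div, le_div_iff₀ (by positivity)]
    exact hk
  linarith [hb (Set.mem_image_of_mem p (subset_closure hx))]

theorem tendsto_modular_of_tendsto_modular_gradient (hN : 2 ≤ N) (hΩ : MeasurableSet Ω)
    (hbdd : Bornology.IsBounded Ω) {b : ℝ} (hp : ∀ x ∈ Ω, 1 ≤ p x) (hpb : ∀ x ∈ Ω, p x ≤ b)
    (hcont : ContinuousOn p (closure Ω)) {ι : Type*} {l : Filter ι}
    {φ : ι → EuclideanSpace ℝ (Fin N) → ℝ} (hφ : ∀ i, IsTestFunction Ω (φ i))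
    (h : Tendsto (fun i => modular Ω p (gradient (φ i))) l (𝓝 0)) :
    Tendsto (fun i => modular Ω p (φ i)) l (𝓝 0) := by
  have hp0 : ∀ x ∈ Ω, 0 ≤ p x := fun x hx => zero_le_one.trans (hp x hx)
  obtain ⟨C, hC⟩ := modularSobolev_self hN hΩ hbdd hp hcont
  refine ENNReal.tendsto_nhds_zero.2 fun ε hε => ?_
  obtain ⟨n, hn⟩ := ENNReal.exists_nat_mul_gt hε.ne' (ENNReal.coe_ne_top (r := C))
  have hn1 : (1 : ℝ) ≤ n := by
    rcases n.eq_zero_or_pos with rfl | hpos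
    · simp at hn
    · exact_mod_cast hpos
  filter_upwards [(tendsto_modular_const_smul hΩ hp0 hpb h (n : ℝ)).eventually_le_const one_pos]
    with i hi
  rw [← gradient_const_smul] at hi
  calc modular Ω p (φ i) = modular Ω p ((n : ℝ)⁻¹ • (n : ℝ) • φ i) := by
        rw [inv_smul_smul₀ (by positivity)]
    _ ≤ ENNReal.ofReal (n : ℝ)⁻¹ * modular Ω p ((n : ℝ) • φ i) :=
        modular_smul_le_of_le_one hΩ hp (by positivity) (inv_le_one_of_one_le₀ hn1) _
    _ ≤ ENNReal.ofReal (n : ℝ)⁻¹ * (n * ε) := by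
        gcongr
        exact (hC _ ((hφ i).const_smul _) hi).trans hn.le
    _ = ε := by
        rw [← mul_assoc, ← ENNReal.ofReal_natCast n, ← ENNReal.ofReal_mul (by positivity),
          inv_mul_cancel₀ (by positivity), ENNReal.ofReal_one, one_mul]

end ModularSobolev

section WeakGradient

variable {N : ℕ} {Ω : Set (EuclideanSpace ℝ (Fin N))} {u φ ψ : EuclideanSpace ℝ (Fin N) → ℝ}
  {G H : EuclideanSpace ℝ (Fin N) → EuclideanSpace ℝ (Fin N)}

theorem IsTestFunction.integrable_smul {F : Type*} [NormedAddCommGroup F] [NormedSpace ℝ F]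
    {f : EuclideanSpace ℝ (Fin N) → F} (hψ : IsTestFunction Ω ψ) (hΩ : IsOpen Ω)
    (hf : LocallyIntegrableOn f Ω) : Integrable (fun x => ψ x • f x) := by
  have h : IntegrableOn (fun x => ψ x • f x) (tsupport ψ) :=
    (hf.continuousOn_smul hΩ.isLocallyClosed
      hψ.1.continuous.continuousOn).integrableOn_compact_subset hψ.2.2 hψ.2.1
  refine (integrableOn_iff_integrable_of_support_subset ?_).1 h
  exact (Function.support_smul_subset_left ψ f).trans (subset_tsupport ψ)

theorem IsTestFunction.setIntegral_mul_inner (hψ : IsTestFunction Ω ψ) (hΩ : IsOpen Ω)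
    (hG : LocallyIntegrableOn G Ω) (e : EuclideanSpace ℝ (Fin N)) :
    ∫ x in Ω, ψ x * inner ℝ (G x) e = inner ℝ e (∫ x in Ω, ψ x • G x) := by
  rw [← integral_inner (hψ.integrable_smul hΩ hG).restrict]
  simp only [inner_smul_right, real_inner_comm]

theorem HasWeakGradient.ae_eq (hΩ : IsOpen Ω) (hG : HasWeakGradient Ω u G)
    (hH : HasWeakGradient Ω u H) : G =ᵐ[volume.restrict Ω] H := by
  have key : ∀ᵐ x, x ∈ Ω → (G - H) x = 0 := by
    refine hΩ.ae_eq_zero_of_integral_contDiff_smul_eq_zero (hG.2.1.sub hH.2.1)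
      fun ψ hψ₁ hψ₂ hψ₃ => ?_
    have hψ : IsTestFunction Ω ψ := ⟨hψ₁, hψ₂, hψ₃⟩
    have heq : ∫ x in Ω, ψ x • G x = ∫ x in Ω, ψ x • H x := by
      refine ext_inner_left ℝ fun e => ?_
      rw [← hψ.setIntegral_mul_inner hΩ hG.2.1, ← hψ.setIntegral_mul_inner hΩ hH.2.1,
        ← neg_inj, ← hG.2.2 ψ hψ e, ← hH.2.2 ψ hψ e]
    rw [← setIntegral_eq_integral_of_forall_compl_eq_zero (s := Ω) fun x hx => by
      rw [image_eq_zero_of_notMem_tsupport fun h => hx (hψ₃ h), zero_smul]]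
    simp only [Pi.sub_apply, smul_sub]
    rw [integral_sub (hψ.integrable_smul hΩ hG.2.1).restrict
      (hψ.integrable_smul hΩ hH.2.1).restrict, heq, sub_self]
  filter_upwards [ae_restrict_of_ae key, ae_restrict_mem hΩ.measurableSet] with x hx hxΩ
  exact sub_eq_zero.1 (hx hxΩ)

theorem HasWeakGradient.weakGradient_ae_eq (hΩ : IsOpen Ω) (hG : HasWeakGradient Ω u G) :
    weakGradient Ω u =ᵐ[volume.restrict Ω] G := by
  have h : ∃ G, HasWeakGradient Ω u G := ⟨G, hG⟩
  rw [weakGradient, dif_pos h]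
  exact h.choose_spec.ae_eq hΩ hG

theorem IsTestFunction.hasWeakGradient (hφ : IsTestFunction Ω φ) :
    HasWeakGradient Ω φ (gradient φ) := by
  refine ⟨hφ.integrable.locallyIntegrable.locallyIntegrableOn Ω,
    hφ.integrable_gradient.locallyIntegrable.locallyIntegrableOn Ω, fun ψ hψ e => ?_⟩
  have hcont {f : EuclideanSpace ℝ (Fin N) → ℝ} (hf : IsTestFunction Ω f) :
      Continuous fun x => fderiv ℝ f x e :=
    (hf.1.continuous_fderiv (by simp)).clm_apply continuous_const
  have hφc := hφ.1.continuous
  have hψc := hψ.1.continuous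
  have by_parts : ∫ x, φ x * fderiv ℝ ψ x e = -∫ x, fderiv ℝ φ x e * ψ x :=
    integral_mul_fderiv_eq_neg_fderiv_mul_of_integrable
      (((hcont hφ).mul hψc).integrable_of_hasCompactSupport hψ.2.1.mul_left)
      ((hφc.mul (hcont hψ)).integrable_of_hasCompactSupport hφ.2.1.mul_right)
      ((hφc.mul hψc).integrable_of_hasCompactSupport hφ.2.1.mul_right)
      (fun x _ => hφ.differentiable x) (fun x _ => hψ.differentiable x)
  rw [setIntegral_eq_integral_of_forall_compl_eq_zero fun x hx => by
      rw [image_eq_zero_of_notMem_tsupport fun h => hx (hφ.2.2 h), zero_mul],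
    setIntegral_eq_integral_of_forall_compl_eq_zero fun x hx => by
      rw [image_eq_zero_of_notMem_tsupport fun h => hx (hψ.2.2 h), zero_mul], by_parts]
  simp only [inner_gradient_left, mul_comm]

theorem tendsto_integral_smul_of_tendsto_eLpNorm {α F ι : Type*} [MeasurableSpace α]
    {μ : Measure α} [NormedAddCommGroup F] [NormedSpace ℝ F] {l : Filter ι} {f : ι → α → F}
    {g : α → F} {w : α → ℝ} {D : ℝ} (hf : ∀ i, Integrable (f i) μ) (hg : Integrable g μ)
    (hw : AEStronglyMeasurable w μ) (hD : ∀ x, ‖w x‖ ≤ D)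
    (h : Tendsto (fun i => eLpNorm (f i - g) 1 μ) l (𝓝 0)) :
    Tendsto (fun i => ∫ x, w x • f i x ∂μ) l (𝓝 (∫ x, w x • g x ∂μ)) := by
  refine tendsto_integral_of_L1' _ (hw.smul hg.aestronglyMeasurable)
    (Eventually.of_forall fun i => (hf i).bdd_smul _ hw (Eventually.of_forall hD)) ?_
  have h0 : Tendsto (fun i => ENNReal.ofReal D * eLpNorm (f i - g) 1 μ) l (𝓝 0) := by
    simpa only [mul_zero] using ENNReal.Tendsto.const_mul h (Or.inr ENNReal.ofReal_ne_top)
  refine tendsto_of_tendsto_of_tendsto_of_le_of_le tendsto_const_nhds h0 (fun _ => zero_le)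
    fun i => eLpNorm_le_mul_eLpNorm_of_ae_le_mul (Eventually.of_forall fun x => ?_) 1
  rw [Pi.sub_apply, Pi.smul_apply', Pi.sub_apply, ← smul_sub, norm_smul]
  exact mul_le_mul_of_nonneg_right (hD x) (norm_nonneg _)

theorem HasWeakGradient.of_tendsto {ι : Type*} {l : Filter ι} [l.NeBot]
    {us : ι → EuclideanSpace ℝ (Fin N) → ℝ}
    {Gs : ι → EuclideanSpace ℝ (Fin N) → EuclideanSpace ℝ (Fin N)} (hΩ : IsOpen Ω)
    (h : ∀ i, HasWeakGradient Ω (us i) (Gs i))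
    (husi : ∀ i, Integrable (us i) (volume.restrict Ω)) (hui : Integrable u (volume.restrict Ω))
    (hus : Tendsto (fun i => eLpNorm (us i - u) 1 (volume.restrict Ω)) l (𝓝 0))
    (hGsi : ∀ i, Integrable (Gs i) (volume.restrict Ω)) (hGi : Integrable G (volume.restrict Ω))
    (hGs : Tendsto (fun i => eLpNorm (Gs i - G) 1 (volume.restrict Ω)) l (𝓝 0)) :
    HasWeakGradient Ω u G := by
  have hG : LocallyIntegrableOn G Ω := IntegrableOn.locallyIntegrableOn hGi
  refine ⟨IntegrableOn.locallyIntegrableOn hui, hG, fun ψ hψ e => ?_⟩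
  have hψ' : Continuous fun x => fderiv ℝ ψ x e :=
    (hψ.1.continuous_fderiv (by simp)).clm_apply continuous_const
  obtain ⟨D, hD⟩ := (hψ.2.1.fderiv_apply ℝ e).exists_bound_of_continuous hψ'
  obtain ⟨D', hD'⟩ := hψ.2.1.exists_bound_of_continuous hψ.1.continuous
  have hleft : Tendsto (fun i => ∫ x in Ω, us i x * fderiv ℝ ψ x e) l
      (𝓝 (∫ x in Ω, u x * fderiv ℝ ψ x e)) := by
    simpa only [smul_eq_mul, mul_comm] using
      tendsto_integral_smul_of_tendsto_eLpNorm husi hui hψ'.aestronglyMeasurable hD hus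
  have hright : Tendsto (fun i => ∫ x in Ω, ψ x * inner ℝ (Gs i x) e) l
      (𝓝 (∫ x in Ω, ψ x * inner ℝ (G x) e)) := by
    simp only [hψ.setIntegral_mul_inner hΩ hG, hψ.setIntegral_mul_inner hΩ (h _).2.1]
    exact tendsto_const_nhds.inner
      (tendsto_integral_smul_of_tendsto_eLpNorm hGsi hGi hψ.aestronglyMeasurable hD' hGs)
  simp only [(h _).2.2 ψ hψ e] at hleft
  exact tendsto_nhds_unique hleft hright.neg

end WeakGradient

section Completeness

theorem tendsto_eLpNorm_sub_of_tendstoUniformlyOn {α F ι : Type*} [MeasurableSpace α]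
    {μ : Measure α} [NormedAddCommGroup F] {s : Set α} (hs : MeasurableSet s) (hs' : μ s ≠ ⊤)
    {l : Filter ι} {f : ι → α → F} {g : α → F} (h : TendstoUniformlyOn f g l s) (r : ℝ≥0∞) :
    Tendsto (fun i => eLpNorm (f i - g) r (μ.restrict s)) l (𝓝 0) := by
  refine ENNReal.tendsto_nhds_zero.2 fun ε hε => ?_
  have hfin : μ s ^ r.toReal⁻¹ ≠ ⊤ := by finiteness
  obtain ⟨η, hη, hηε⟩ := ENNReal.exists_nnreal_pos_mul_lt hfin hε.ne'
  filter_upwards [Metric.tendstoUniformlyOn_iff.1 h η (NNReal.coe_pos.2 hη)] with i hi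
  have hbound : ∀ᵐ x ∂μ.restrict s, ‖(f i - g) x‖ₑ ≤ η := by
    filter_upwards [ae_restrict_mem hs] with x hx
    rw [Pi.sub_apply, ← edist_eq_enorm_sub, edist_comm, edist_nndist]
    exact_mod_cast (hi x hx).le
  refine (eLpNorm_le_of_ae_enorm_bound hbound).trans ?_
  rw [Measure.restrict_apply_univ, smul_eq_mul]
  exact hηε.le

theorem exists_memLp_tendsto_eLpNorm {α F : Type*} [MeasurableSpace α] {μ : Measure α}
    [NormedAddCommGroup F] [CompleteSpace F] {r : ℝ≥0∞} [Fact (1 ≤ r)] {f : ℕ → α → F}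
    (hf : ∀ n, MemLp (f n) r μ)
    (hcau : Tendsto (fun i : ℕ × ℕ => eLpNorm (f i.1 - f i.2) r μ) atTop (𝓝 0)) :
    ∃ g, MemLp g r μ ∧ Tendsto (fun n => eLpNorm (f n - g) r μ) atTop (𝓝 0) := by
  have hC : CauchySeq fun n => (hf n).toLp := by
    refine (Lp.cauchySeq_Lp_iff_cauchySeq_eLpNorm _).2 (hcau.congr fun i => eLpNorm_congr_ae ?_)
    exact ((hf i.1).coeFn_toLp.sub (hf i.2).coeFn_toLp).symm
  obtain ⟨g, hg⟩ := cauchySeq_tendsto_of_complete hC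
  refine ⟨g, Lp.memLp g, ((Lp.tendsto_Lp_iff_tendsto_eLpNorm' _ g).1 hg).congr fun n => ?_⟩
  exact eLpNorm_congr_ae ((hf n).coeFn_toLp.sub EventuallyEq.rfl)

variable {N : ℕ} {Ω : Set (EuclideanSpace ℝ (Fin N))} {p : EuclideanSpace ℝ (Fin N) → ℝ}
  {F : Type*} [NormedAddCommGroup F]

theorem modular_sub_comm (f g : EuclideanSpace ℝ (Fin N) → F) :
    modular Ω p (f - g) = modular Ω p (g - f) := by
  simp only [modular, Pi.sub_apply, norm_sub_rev]

theorem MemLpVar.memLp_one {f : EuclideanSpace ℝ (Fin N) → F} (hf : MemLpVar Ω p f)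
    (hΩ : MeasurableSet Ω) (hΩ' : volume Ω ≠ ⊤) (hp : ∀ x ∈ Ω, 1 ≤ p x) :
    MemLp f 1 (volume.restrict Ω) := by
  refine ⟨hf.1, ?_⟩
  rw [← modular_one]
  exact (modular_le_measure_add hΩ (fun _ _ => zero_le_one) hp f).trans_lt
    (ENNReal.add_lt_top.2 ⟨hΩ'.lt_top, hf.2⟩)

theorem memLpVar_of_continuous_of_hasCompactSupport {b : ℝ} (hΩ : MeasurableSet Ω)
    (hΩ' : volume Ω ≠ ⊤) (hp : ∀ x ∈ Ω, 0 ≤ p x) (hpb : ∀ x ∈ Ω, p x ≤ b)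
    {f : EuclideanSpace ℝ (Fin N) → F} (hf : Continuous f) (hfc : HasCompactSupport f) :
    MemLpVar Ω p f := by
  refine ⟨hf.aestronglyMeasurable, ?_⟩
  have hr : max 1 b.toNNReal ≠ 0 := (zero_lt_one.trans_le (le_max_left _ _)).ne'
  have hpr (x) (hx : x ∈ Ω) : p x ≤ (max 1 b.toNNReal : ℝ≥0) :=
    (hpb x hx).trans ((Real.le_coe_toNNReal b).trans (by exact_mod_cast le_max_right _ _))
  refine (modular_le_measure_add hΩ hp hpr f).trans_lt (ENNReal.add_lt_top.2 ⟨hΩ'.lt_top, ?_⟩)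
  rw [modular_const hr]
  exact ENNReal.rpow_lt_top_of_nonneg (NNReal.coe_nonneg _)
    ((hf.memLp_of_hasCompactSupport hfc).restrict Ω).eLpNorm_ne_top

theorem MemLpVar.of_tendsto {b : ℝ} (hΩ : MeasurableSet Ω) (hp : ∀ x ∈ Ω, 0 ≤ p x)
    (hpb : ∀ x ∈ Ω, p x ≤ b) (hpm : AEMeasurable p (volume.restrict Ω)) {ι : Type*} {l : Filter ι}
    [l.NeBot] {f : ι → EuclideanSpace ℝ (Fin N) → F} {g : EuclideanSpace ℝ (Fin N) → F}
    (hf : ∀ i, MemLpVar Ω p (f i)) (hg : AEStronglyMeasurable g (volume.restrict Ω))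
    (h : Tendsto (fun i => modular Ω p (f i - g)) l (𝓝 0)) : MemLpVar Ω p g := by
  refine ⟨hg, ?_⟩
  obtain ⟨i, hi⟩ := (h.eventually_lt_const ENNReal.zero_lt_top).exists
  rw [modular_sub_comm] at hi
  rw [← add_sub_cancel (f i) g]
  exact (modular_add_le hΩ hp hpb hpm (hf i).1 _).trans_lt
    (ENNReal.mul_lt_top ENNReal.ofReal_lt_top (ENNReal.add_lt_top.2 ⟨(hf i).2, hi⟩))

theorem modular_le_of_tendsto_eLpNorm (hΩ : MeasurableSet Ω) (hp : ∀ x ∈ Ω, 0 < p x)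
    (hpm : AEMeasurable p (volume.restrict Ω)) {f : ℕ → EuclideanSpace ℝ (Fin N) → F}
    {g : EuclideanSpace ℝ (Fin N) → F} (hf : ∀ n, AEStronglyMeasurable (f n) (volume.restrict Ω))
    (hg : AEStronglyMeasurable g (volume.restrict Ω))
    (hfg : Tendsto (fun n => eLpNorm (f n - g) 1 (volume.restrict Ω)) atTop (𝓝 0)) {M : ℝ≥0∞}
    (hM : ∀ᶠ n in atTop, modular Ω p (f n) ≤ M) : modular Ω p g ≤ M := by
  obtain ⟨ns, hns, hae⟩ :=
    (tendstoInMeasure_of_tendsto_eLpNorm one_ne_zero hf hg hfg).exists_seq_tendsto_ae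
  exact (modular_le_liminf hΩ hp hpm (fun i => hf (ns i)) hae).trans
    (liminf_le_of_frequently_le' (hns.tendsto_atTop.eventually hM).frequently)

theorem tendsto_modular_sub_of_cauchy (hΩ : MeasurableSet Ω) (hp : ∀ x ∈ Ω, 0 < p x)
    (hpm : AEMeasurable p (volume.restrict Ω)) {f : ℕ → EuclideanSpace ℝ (Fin N) → F}
    {g : EuclideanSpace ℝ (Fin N) → F} (hf : ∀ n, AEStronglyMeasurable (f n) (volume.restrict Ω))
    (hg : AEStronglyMeasurable g (volume.restrict Ω))
    (hcau : Tendsto (fun i : ℕ × ℕ => modular Ω p (f i.1 - f i.2)) atTop (𝓝 0))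
    (hfg : Tendsto (fun n => eLpNorm (f n - g) 1 (volume.restrict Ω)) atTop (𝓝 0)) :
    Tendsto (fun n => modular Ω p (f n - g)) atTop (𝓝 0) := by
  refine ENNReal.tendsto_atTop_zero.2 fun ε hε => ?_
  obtain ⟨⟨K, L⟩, hK⟩ := eventually_atTop.1 (hcau.eventually_le_const hε)
  refine ⟨K, fun n hn => ?_⟩
  rw [modular_sub_comm]
  refine modular_le_of_tendsto_eLpNorm hΩ hp hpm (f := fun k => f k - f n)
    (fun k => (hf k).sub (hf n)) (hg.sub (hf n)) (by simpa only [sub_sub_sub_cancel_right]) ?_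
  filter_upwards [eventually_ge_atTop L] with k hk
  exact (modular_sub_comm _ _).trans_le (hK (n, k) ⟨hn, hk⟩)

variable [NormedSpace ℝ F]

theorem luxNorm_le_of_tendsto {b m : ℝ} (hΩ : MeasurableSet Ω) (hΩ' : volume Ω ≠ ⊤)
    (hp : ∀ x ∈ Ω, 1 ≤ p x) (hpb : ∀ x ∈ Ω, p x ≤ b) (hpm : AEMeasurable p (volume.restrict Ω))
    {f : ℕ → EuclideanSpace ℝ (Fin N) → F} {g : EuclideanSpace ℝ (Fin N) → F}
    (hf : ∀ n, AEStronglyMeasurable (f n) (volume.restrict Ω))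
    (hg : AEStronglyMeasurable g (volume.restrict Ω))
    (hfg : Tendsto (fun n => modular Ω p (f n - g)) atTop (𝓝 0)) (hm : 0 < m) {S : ℝ≥0∞}
    (hlim : Tendsto (fun n => modular Ω p (m⁻¹ • f n)) atTop (𝓝 S)) (hS : S ≤ 1) :
    luxNorm Ω p g ≤ ENNReal.ofReal m := by
  have hp0 : ∀ x ∈ Ω, 0 < p x := fun x hx => zero_lt_one.trans_le (hp x hx)
  have hconv : Tendsto (fun n => eLpNorm (m⁻¹ • f n - m⁻¹ • g) 1 (volume.restrict Ω)) atTop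
      (𝓝 0) := by
    simp only [← smul_sub]
    exact tendsto_eLpNorm_one_of_tendsto_modular hΩ hΩ' hp hpb
      (tendsto_modular_const_smul hΩ (fun x hx => (hp0 x hx).le) hpb hfg m⁻¹)
  refine luxNorm_le_ofReal hm (le_of_forall_gt_imp_ge_of_dense fun M hM => ?_)
  exact modular_le_of_tendsto_eLpNorm hΩ hp0 hpm (fun n => (hf n).const_smul _) (hg.const_smul _)
    hconv (hlim.eventually_le_const (hS.trans_lt hM))

theorem exists_memLpVar_tendsto_modular_sub [CompleteSpace F] {b : ℝ}
    (hΩ : MeasurableSet Ω) (hΩ' : volume Ω ≠ ⊤) (hp : ∀ x ∈ Ω, 1 ≤ p x) (hpb : ∀ x ∈ Ω, p x ≤ b)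
    (hpm : AEMeasurable p (volume.restrict Ω)) {f : ℕ → EuclideanSpace ℝ (Fin N) → F}
    (hf : ∀ n, MemLpVar Ω p (f n))
    (hcau : Tendsto (fun i : ℕ × ℕ => modular Ω p (f i.1 - f i.2)) atTop (𝓝 0)) :
    ∃ g, MemLpVar Ω p g ∧ Tendsto (fun n => modular Ω p (f n - g)) atTop (𝓝 0) := by
  have hp0 : ∀ x ∈ Ω, 0 < p x := fun x hx => zero_lt_one.trans_le (hp x hx)
  obtain ⟨g, hg, hfg⟩ := exists_memLp_tendsto_eLpNorm
    (fun n => (hf n).memLp_one hΩ hΩ' hp)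
    (tendsto_eLpNorm_one_of_tendsto_modular hΩ hΩ' hp hpb hcau)
  have h := tendsto_modular_sub_of_cauchy hΩ hp0 hpm (fun n => (hf n).1) hg.1 hcau hfg
  exact ⟨g, .of_tendsto hΩ (fun x hx => (hp0 x hx).le) hpb hpm hf hg.1 h, h⟩

end Completeness

section ClosureOfTestFunctions

variable {N : ℕ} {Ω : Set (EuclideanSpace ℝ (Fin N))} {p : EuclideanSpace ℝ (Fin N) → ℝ}

theorem IsTestFunction.memLpVar {φ : EuclideanSpace ℝ (Fin N) → ℝ} (hφ : IsTestFunction Ω φ)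
    {b : ℝ} (hΩ : MeasurableSet Ω) (hΩ' : volume Ω ≠ ⊤) (hp : ∀ x ∈ Ω, 0 ≤ p x)
    (hpb : ∀ x ∈ Ω, p x ≤ b) : MemLpVar Ω p φ :=
  memLpVar_of_continuous_of_hasCompactSupport hΩ hΩ' hp hpb hφ.1.continuous hφ.2.1

theorem IsTestFunction.memLpVar_gradient {φ : EuclideanSpace ℝ (Fin N) → ℝ}
    (hφ : IsTestFunction Ω φ) {b : ℝ} (hΩ : MeasurableSet Ω) (hΩ' : volume Ω ≠ ⊤)
    (hp : ∀ x ∈ Ω, 0 ≤ p x) (hpb : ∀ x ∈ Ω, p x ≤ b) : MemLpVar Ω p (gradient φ) :=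
  memLpVar_of_continuous_of_hasCompactSupport hΩ hΩ' hp hpb (continuous_gradient hφ.contDiff_one)
    hφ.hasCompactSupport_gradient

theorem HasWeakGradient.of_tendsto_modular {b : ℝ} (hΩ : IsOpen Ω) (hΩ' : volume Ω ≠ ⊤)
    (hp : ∀ x ∈ Ω, 1 ≤ p x) (hpb : ∀ x ∈ Ω, p x ≤ b) {ι : Type*} {l : Filter ι} [l.NeBot]
    {φ : ι → EuclideanSpace ℝ (Fin N) → ℝ} {u : EuclideanSpace ℝ (Fin N) → ℝ}
    {G : EuclideanSpace ℝ (Fin N) → EuclideanSpace ℝ (Fin N)} (hφ : ∀ i, IsTestFunction Ω (φ i))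
    (hu : MemLpVar Ω p u) (hφu : Tendsto (fun i => modular Ω p (φ i - u)) l (𝓝 0))
    (hG : MemLpVar Ω p G) (hφG : Tendsto (fun i => modular Ω p (gradient (φ i) - G)) l (𝓝 0)) :
    HasWeakGradient Ω u G :=
  .of_tendsto hΩ (fun i => (hφ i).hasWeakGradient) (fun i => (hφ i).integrable.restrict)
    (memLp_one_iff_integrable.1 (hu.memLp_one hΩ.measurableSet hΩ' hp))
    (tendsto_eLpNorm_one_of_tendsto_modular hΩ.measurableSet hΩ' hp hpb hφu)
    (fun i => (hφ i).integrable_gradient.restrict)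
    (memLp_one_iff_integrable.1 (hG.memLp_one hΩ.measurableSet hΩ' hp))
    (tendsto_eLpNorm_one_of_tendsto_modular hΩ.measurableSet hΩ' hp hpb hφG)

theorem MemW10.of_tendsto_modular {b : ℝ} (hΩ : IsOpen Ω) (hΩ' : volume Ω ≠ ⊤)
    (hp : ∀ x ∈ Ω, 1 ≤ p x) (hpb : ∀ x ∈ Ω, p x ≤ b) {ι : Type*} {l : Filter ι} [l.NeBot]
    {φ : ι → EuclideanSpace ℝ (Fin N) → ℝ} {u : EuclideanSpace ℝ (Fin N) → ℝ}
    {G : EuclideanSpace ℝ (Fin N) → EuclideanSpace ℝ (Fin N)} (hφ : ∀ i, IsTestFunction Ω (φ i))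
    (hu : MemLpVar Ω p u) (hφu : Tendsto (fun i => modular Ω p (φ i - u)) l (𝓝 0))
    (hG : MemLpVar Ω p G) (hφG : Tendsto (fun i => modular Ω p (gradient (φ i) - G)) l (𝓝 0)) :
    MemW10 Ω p u := by
  have hp0 : ∀ x ∈ Ω, 0 ≤ p x := fun x hx => zero_le_one.trans (hp x hx)
  have hweak : HasWeakGradient Ω u G := .of_tendsto_modular hΩ hΩ' hp hpb hφ hu hφu hG hφG
  have hae : weakGradient Ω u =ᵐ[volume.restrict Ω] G := hweak.weakGradient_ae_eq hΩ
  have hmod : MemLpVar Ω p (weakGradient Ω u) :=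
    ⟨hG.1.congr hae.symm, (modular_congr_ae hae).trans_lt hG.2⟩
  have hconv₀ : Tendsto (fun i => luxNorm Ω p (u - φ i)) l (𝓝 0) := by
    refine tendsto_luxNorm_of_tendsto_modular hΩ.measurableSet hp0 hpb ?_
    simpa only [modular_sub_comm u] using hφu
  have hconv₁ : Tendsto (fun i => luxNorm Ω p (weakGradient Ω u - gradient (φ i))) l (𝓝 0) := by
    refine tendsto_luxNorm_of_tendsto_modular hΩ.measurableSet hp0 hpb (hφG.congr fun i => ?_)
    rw [modular_sub_comm]
    exact modular_congr_ae (hae.symm.sub EventuallyEq.rfl)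
  refine ⟨⟨hu, ⟨G, hweak⟩, hmod⟩, fun ε hε => ?_⟩
  have hsum := hconv₀.add hconv₁
  rw [add_zero] at hsum
  obtain ⟨i, hi⟩ := (hsum.eventually_lt_const hε).exists
  exact ⟨φ i, hφ i, hi⟩

end ClosureOfTestFunctions

section MinimizingSequence

variable {T : Type*} {A : ℕ → Set T} {Φ : T → ℝ≥0∞}

theorem monotone_iInf_of_antitone (hA : Antitone A) : Monotone fun n => ⨅ t ∈ A n, Φ t :=
  fun _ _ hmn => biInf_mono fun _ ht => hA hmn ht

theorem exists_seq_tendsto_iSup_iInf (hA : Antitone A) (hS : ⨆ n, ⨅ t ∈ A n, Φ t ≠ ⊤) :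
    ∃ t : ℕ → T, (∀ n, t n ∈ A n) ∧
      Tendsto (fun n => Φ (t n)) atTop (𝓝 (⨆ n, ⨅ t ∈ A n, Φ t)) := by
  have hlt (n : ℕ) : ⨅ t ∈ A n, Φ t < (⨅ t ∈ A n, Φ t) + ((n + 1 : ℕ) : ℝ≥0∞)⁻¹ :=
    ENNReal.lt_add_right (ne_top_of_le_ne_top hS (le_iSup (fun n => ⨅ t ∈ A n, Φ t) n)) (by simp)
  have hex (n : ℕ) : ∃ t ∈ A n, Φ t < (⨅ t ∈ A n, Φ t) + ((n + 1 : ℕ) : ℝ≥0∞)⁻¹ := by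
    simpa only [iInf_lt_iff, exists_prop] using hlt n
  choose t ht hΦ using hex
  have hI := tendsto_atTop_iSup (monotone_iInf_of_antitone (Φ := Φ) hA)
  have hI' := hI.add (ENNReal.tendsto_inv_nat_nhds_zero.comp (tendsto_add_atTop_nat 1))
  rw [add_zero] at hI'
  exact ⟨t, ht, tendsto_of_tendsto_of_tendsto_of_le_of_le hI hI' (fun n => iInf₂_le _ (ht n))
    fun n => (hΦ n).le⟩

-- The parallelogram argument: midpoints of `t m` and `t n` stay in `A (min m n)`, so `Φ` cannot
-- drop there by more than a vanishing amount.
theorem tendsto_zero_of_uniform_convexity (hA : Antitone A) (hS : ⨆ n, ⨅ t ∈ A n, Φ t ≠ ⊤)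
    {mid : T → T → T} (hmid : ∀ n, ∀ s ∈ A n, ∀ t ∈ A n, mid s t ∈ A n) {D : T → T → ℝ≥0∞}
    (hconv : ∀ ε : ℝ≥0, 0 < ε → ∃ C : ℝ≥0, ∀ s ∈ A 0, ∀ t ∈ A 0,
      D s t + 2 * C * Φ (mid s t) ≤ (ε + C) * (Φ s + Φ t)) {t : ℕ → T} (ht : ∀ n, t n ∈ A n)
    (hΦ : Tendsto (fun n => Φ (t n)) atTop (𝓝 (⨆ n, ⨅ t ∈ A n, Φ t))) :
    Tendsto (fun i : ℕ × ℕ => D (t i.1) (t i.2)) atTop (𝓝 0) := by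
  set I : ℕ → ℝ≥0∞ := fun n => ⨅ t ∈ A n, Φ t
  set S : ℝ≥0∞ := ⨆ n, I n
  have hmin : Tendsto (fun i : ℕ × ℕ => min i.1 i.2) atTop atTop :=
    tendsto_atTop.2 fun K => (eventually_ge_atTop (K, K)).mono fun i hi => le_min hi.1 hi.2
  have hI : Tendsto (fun i : ℕ × ℕ => I (min i.1 i.2)) atTop (𝓝 S) :=
    (tendsto_atTop_iSup (monotone_iInf_of_antitone hA)).comp hmin
  have hsum : Tendsto (fun i : ℕ × ℕ => Φ (t i.1) + Φ (t i.2)) atTop (𝓝 (S + S)) := by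
    rw [← prod_atTop_atTop_eq]
    exact (hΦ.comp tendsto_fst).add (hΦ.comp tendsto_snd)
  refine ENNReal.tendsto_nhds_zero.2 fun η hη => ?_
  obtain ⟨ε, hε, hεη⟩ := ENNReal.exists_nnreal_pos_mul_lt (ENNReal.add_ne_top.2 ⟨hS, hS⟩) hη.ne'
  obtain ⟨C, hC⟩ := hconv ε hε
  have hbound (i : ℕ × ℕ) : D (t i.1) (t i.2) ≤
      (ε + C) * (Φ (t i.1) + Φ (t i.2)) - 2 * C * I (min i.1 i.2) := by
    have h₁ := hA (min_le_left i.1 i.2) (ht i.1)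
    have h₂ := hA (min_le_right i.1 i.2) (ht i.2)
    have hle : I (min i.1 i.2) ≤ Φ (mid (t i.1) (t i.2)) := iInf₂_le _ (hmid _ _ h₁ _ h₂)
    refine ENNReal.le_sub_of_add_le_right ?_ (le_trans (by gcongr)
      (hC _ (hA (Nat.zero_le _) h₁) _ (hA (Nat.zero_le _) h₂)))
    finiteness [ne_top_of_le_ne_top hS (le_iSup I (min i.1 i.2))]
  have hlim : Tendsto (fun i : ℕ × ℕ => (ε + C) * (Φ (t i.1) + Φ (t i.2)) -
      2 * C * I (min i.1 i.2)) atTop (𝓝 (ε * (S + S))) := by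
    have heq : (ε + C) * (S + S) - 2 * C * S = ε * (S + S) := by
      rw [add_mul, two_mul, add_mul, mul_add (C : ℝ≥0∞)]
      exact ENNReal.add_sub_cancel_right (by finiteness)
    rw [← heq]
    exact ENNReal.Tendsto.sub (ENNReal.Tendsto.const_mul hsum (Or.inr (by finiteness)))
      (ENNReal.Tendsto.const_mul hI (Or.inr (by finiteness))) (Or.inl (by finiteness))
  filter_upwards [hlim.eventually_lt_const hεη] with i hi
  exact (hbound i).trans hi.le

end MinimizingSequence

section NearbyTestFunctions

variable {N : ℕ} {Ω : Set (EuclideanSpace ℝ (Fin N))} {p : EuclideanSpace ℝ (Fin N) → ℝ}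
  {u : EuclideanSpace ℝ (Fin N) → ℝ}

/-- The test functions at `L¹(Ω)`-distance at most `δ` from `u`; as `δ` decreases to `0`, the infima
over these sets of a functional of `∇φ` increase to its relaxation at `u`. -/
def testFunctionsNear (Ω : Set (EuclideanSpace ℝ (Fin N))) (u : EuclideanSpace ℝ (Fin N) → ℝ)
    (δ : ℝ≥0∞) : Set (EuclideanSpace ℝ (Fin N) → ℝ) :=
  {φ | IsTestFunction Ω φ ∧ eLpNorm (φ - u) 1 (volume.restrict Ω) ≤ δ}

theorem antitone_testFunctionsNear_inv :
    Antitone fun n : ℕ => testFunctionsNear Ω u ((n + 1 : ℕ) : ℝ≥0∞)⁻¹ := fun m n hmn φ hφ =>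
  ⟨hφ.1, hφ.2.trans (ENNReal.inv_le_inv.2 (by exact_mod_cast Nat.succ_le_succ hmn))⟩

theorem midpoint_mem_testFunctionsNear (hu : AEStronglyMeasurable u (volume.restrict Ω))
    {δ : ℝ≥0∞} {φ ψ : EuclideanSpace ℝ (Fin N) → ℝ} (hφ : φ ∈ testFunctionsNear Ω u δ)
    (hψ : ψ ∈ testFunctionsNear Ω u δ) : (1 / 2 : ℝ) • (φ + ψ) ∈ testFunctionsNear Ω u δ := by
  refine ⟨(hφ.1.add hψ.1).const_smul _, ?_⟩
  have hmid : (1 / 2 : ℝ) • (φ + ψ) - u = (1 / 2 : ℝ) • ((φ - u) + (ψ - u)) := by module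
  have hhalf : ‖(1 / 2 : ℝ)‖ₑ = 2⁻¹ := by
    rw [one_div, enorm_inv two_ne_zero, Real.enorm_of_nonneg zero_le_two, ENNReal.ofReal_ofNat]
  calc eLpNorm ((1 / 2 : ℝ) • (φ + ψ) - u) 1 (volume.restrict Ω)
      = 2⁻¹ * eLpNorm ((φ - u) + (ψ - u)) 1 (volume.restrict Ω) := by
        rw [hmid, eLpNorm_const_smul, hhalf]
    _ ≤ 2⁻¹ * (δ + δ) := by
        gcongr
        exact (eLpNorm_add_le (hφ.1.aestronglyMeasurable.sub hu)
          (hψ.1.aestronglyMeasurable.sub hu) le_rfl).trans (add_le_add hφ.2 hψ.2)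
    _ = δ := by
        rw [← two_mul, ← mul_assoc, ENNReal.inv_mul_cancel two_ne_zero ENNReal.ofNat_ne_top,
          one_mul]

theorem exists_seq_tendsto_modular_gradient {a b : ℝ} (hΩ : MeasurableSet Ω) (ha : 1 < a)
    (hap : ∀ x ∈ Ω, a ≤ p x) (hpb : ∀ x ∈ Ω, p x ≤ b) (hpm : AEMeasurable p (volume.restrict Ω))
    (hu : AEStronglyMeasurable u (volume.restrict Ω)) {c : ℝ} {S : ℝ≥0∞} (hS : S ≠ ⊤)
    (hSc : ⨆ n : ℕ, ⨅ φ ∈ testFunctionsNear Ω u ((n + 1 : ℕ) : ℝ≥0∞)⁻¹,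
      modular Ω p (c • gradient φ) = S) :
    ∃ φ : ℕ → EuclideanSpace ℝ (Fin N) → ℝ, (∀ n, IsTestFunction Ω (φ n)) ∧
      Tendsto (fun n => eLpNorm (φ n - u) 1 (volume.restrict Ω)) atTop (𝓝 0) ∧
      Tendsto (fun n => modular Ω p (c • gradient (φ n))) atTop (𝓝 S) ∧
      Tendsto (fun i : ℕ × ℕ => modular Ω p (c • gradient (φ i.1) - c • gradient (φ i.2)))
        atTop (𝓝 0) := by
  subst hSc
  obtain ⟨φ, hφ, hlim⟩ := exists_seq_tendsto_iSup_iInf antitone_testFunctionsNear_inv hS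
  refine ⟨φ, fun n => (hφ n).1, ?_, hlim, ?_⟩
  · exact tendsto_of_tendsto_of_tendsto_of_le_of_le tendsto_const_nhds
      (ENNReal.tendsto_inv_nat_nhds_zero.comp (tendsto_add_atTop_nat 1)) (fun _ => zero_le)
      fun n => (hφ n).2
  refine tendsto_zero_of_uniform_convexity antitone_testFunctionsNear_inv hS
    (fun n φ hφ ψ hψ => midpoint_mem_testFunctionsNear hu hφ hψ)
    (D := fun φ ψ => modular Ω p (c • gradient φ - c • gradient ψ)) (fun ε hε => ?_) hφ hlim
  obtain ⟨C, hC⟩ := exists_modular_uniform_convexity (F := EuclideanSpace ℝ (Fin N)) hΩ ha hap hpb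
    hpm hε
  refine ⟨C, fun φ hφ ψ hψ => ?_⟩
  have hgrad : c • gradient ((1 / 2 : ℝ) • (φ + ψ)) =
      (1 / 2 : ℝ) • (c • gradient φ + c • gradient ψ) := by
    rw [gradient_const_smul, gradient_add hφ.1.differentiable hψ.1.differentiable, ← smul_add,
      smul_comm]
  rw [hgrad]
  exact hC _ _ (hφ.1.aestronglyMeasurable_gradient.const_smul c)
    (hψ.1.aestronglyMeasurable_gradient.const_smul c)

theorem memW10_of_cauchy_gradient {b : ℝ} (hN : 2 ≤ N) (hΩ : IsOpen Ω)
    (hbdd : Bornology.IsBounded Ω) (hp : ∀ x ∈ Ω, 1 ≤ p x) (hpb : ∀ x ∈ Ω, p x ≤ b)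
    (hcont : ContinuousOn p (closure Ω)) {φ : ℕ → EuclideanSpace ℝ (Fin N) → ℝ}
    (hφ : ∀ n, IsTestFunction Ω (φ n)) (hu : AEStronglyMeasurable u (volume.restrict Ω))
    (hφu : Tendsto (fun n => eLpNorm (φ n - u) 1 (volume.restrict Ω)) atTop (𝓝 0))
    (hcau : Tendsto (fun i : ℕ × ℕ => modular Ω p (gradient (φ i.1) - gradient (φ i.2)))
      atTop (𝓝 0)) :
    MemW10 Ω p u ∧
      Tendsto (fun n => modular Ω p (gradient (φ n) - weakGradient Ω u)) atTop (𝓝 0) := by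
  have hp0 : ∀ x ∈ Ω, 0 < p x := fun x hx => zero_lt_one.trans_le (hp x hx)
  have hp0' : ∀ x ∈ Ω, 0 ≤ p x := fun x hx => (hp0 x hx).le
  have hΩm := hΩ.measurableSet
  have hΩ' : volume Ω ≠ ⊤ := hbdd.measure_lt_top.ne
  have hpm : AEMeasurable p (volume.restrict Ω) := (hcont.mono subset_closure).aemeasurable hΩm
  obtain ⟨G, hG, hφG⟩ := exists_memLpVar_tendsto_modular_sub hΩm hΩ' hp hpb hpm
    (fun n => (hφ n).memLpVar_gradient hΩm hΩ' hp0' hpb) hcau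
  have hφcau : Tendsto (fun i : ℕ × ℕ => modular Ω p (φ i.1 - φ i.2)) atTop (𝓝 0) := by
    refine tendsto_modular_of_tendsto_modular_gradient hN hΩm hbdd hp hpb hcont
      (fun i => (hφ i.1).sub (hφ i.2)) (hcau.congr fun i => ?_)
    rw [gradient_sub (hφ i.1).differentiable (hφ i.2).differentiable]
  have hφu' : Tendsto (fun n => modular Ω p (φ n - u)) atTop (𝓝 0) :=
    tendsto_modular_sub_of_cauchy hΩm hp0 hpm (fun n => (hφ n).aestronglyMeasurable) hu hφcau hφu
  have hu' : MemLpVar Ω p u :=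
    .of_tendsto hΩm hp0' hpb hpm (fun n => (hφ n).memLpVar hΩm hΩ' hp0' hpb) hu hφu'
  have hae : weakGradient Ω u =ᵐ[volume.restrict Ω] G :=
    (HasWeakGradient.of_tendsto_modular hΩ hΩ' hp hpb hφ hu' hφu' hG hφG).weakGradient_ae_eq hΩ
  exact ⟨.of_tendsto_modular hΩ hΩ' hp hpb hφ hu' hφu' hG hφG,
    hφG.congr fun n => modular_congr_ae (EventuallyEq.rfl.sub hae.symm)⟩

theorem energy_le_of_iSup_iInf_modular_le {a m : ℝ} (hN : 2 ≤ N) (hΩ : IsOpen Ω)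
    (hbdd : Bornology.IsBounded Ω) (hcont : ContinuousOn p (closure Ω)) (ha : 1 < a)
    (hap : ∀ x ∈ Ω, a ≤ p x) (u : Lp ℝ 1 (volume.restrict Ω)) (hm : 0 < m)
    (h : ⨆ n : ℕ, ⨅ φ ∈ testFunctionsNear Ω u ((n + 1 : ℕ) : ℝ≥0∞)⁻¹,
      modular Ω p (m⁻¹ • gradient φ) ≤ 1) : energy Ω p u ≤ ENNReal.ofReal m := by
  obtain ⟨b, hb⟩ := hbdd.isCompact_closure.bddAbove_image hcont
  have hpb : ∀ x ∈ Ω, p x ≤ b := fun x hx => hb (Set.mem_image_of_mem p (subset_closure hx))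
  have hp : ∀ x ∈ Ω, 1 ≤ p x := fun x hx => ha.le.trans (hap x hx)
  have hΩm := hΩ.measurableSet
  have hΩ' : volume Ω ≠ ⊤ := hbdd.measure_lt_top.ne
  have hpm : AEMeasurable p (volume.restrict Ω) := (hcont.mono subset_closure).aemeasurable hΩm
  have hu := Lp.aestronglyMeasurable u
  obtain ⟨φ, hφ, hφu, hlim, hcau⟩ := exists_seq_tendsto_modular_gradient hΩm ha hap hpb hpm hu
    (ne_top_of_le_ne_top ENNReal.one_ne_top h) rfl
  have hgradcau : Tendsto (fun i : ℕ × ℕ => modular Ω p (gradient (φ i.1) - gradient (φ i.2)))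
      atTop (𝓝 0) := by
    simpa only [← smul_sub, smul_inv_smul₀ hm.ne'] using
      tendsto_modular_const_smul hΩm (fun x hx => zero_le_one.trans (hp x hx)) hpb hcau m
  obtain ⟨hW, hconv⟩ := memW10_of_cauchy_gradient hN hΩ hbdd hp hpb hcont hφ hu hφu hgradcau
  rw [energy, if_pos hW]
  exact luxNorm_le_of_tendsto hΩm hΩ' hp hpb hpm (fun n => (hφ n).aestronglyMeasurable_gradient)
    hW.1.2.2.1 hconv hm hlim h

end NearbyTestFunctions

section GammaLiminf

theorem frequently_exists_lt_of_gammaLiminf_lt {X Y : Type*} [TopologicalSpace X]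
    [CompleteLinearOrder Y] {f : ℕ → X → Y} {u : X} {c : Y} (h : gammaLiminf f u < c) {U : Set X}
    (hU : IsOpen U) (hu : u ∈ U) : ∃ᶠ n in atTop, ∃ v ∈ U, f n v < c := by
  have hle : liminf (fun n => ⨅ v ∈ U, f n v) atTop ≤ gammaLiminf f u :=
    le_iSup_of_le U (le_iSup_of_le hU (le_iSup_of_le hu le_rfl))
  refine (frequently_lt_of_liminf_lt (by isBoundedDefault) (hle.trans_lt h)).mono fun n hn => ?_
  simpa only [iInf_lt_iff, exists_prop] using hn

variable {N : ℕ} {Ω : Set (EuclideanSpace ℝ (Fin N))} {p : EuclideanSpace ℝ (Fin N) → ℝ}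

theorem exists_testFunction_of_energy_lt (hΩ : MeasurableSet Ω) (hΩ' : volume Ω ≠ ⊤)
    (hp : ∀ x ∈ Ω, 1 ≤ p x) (hpm : AEMeasurable p (volume.restrict Ω))
    {v : Lp ℝ 1 (volume.restrict Ω)} {c : ℝ≥0∞} (h : energy Ω p v < c) {δ : ℝ≥0∞} (hδ : 0 < δ) :
    ∃ φ ∈ testFunctionsNear Ω v δ, luxNorm Ω p (gradient φ) < c := by
  unfold energy at h
  split_ifs at h with hv
  swap
  · exact absurd h not_top_lt
  have hV : volume Ω + 1 ≠ ⊤ := ENNReal.add_ne_top.2 ⟨hΩ', ENNReal.one_ne_top⟩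
  obtain ⟨φ, hφ, hlt⟩ := hv.2 (min (δ / (volume Ω + 1)) (c - luxNorm Ω p (weakGradient Ω v)))
    (lt_min (ENNReal.div_pos hδ.ne' hV) (tsub_pos_of_lt h))
  have hltφ : luxNorm Ω p (φ - ⇑v) < δ / (volume Ω + 1) := by
    rw [luxNorm_sub_comm]
    exact (le_self_add.trans_lt hlt).trans_le (min_le_left _ _)
  have hltG : luxNorm Ω p (gradient φ - weakGradient Ω v) <
      c - luxNorm Ω p (weakGradient Ω v) := by
    rw [luxNorm_sub_comm]
    exact (le_add_self.trans_lt hlt).trans_le (min_le_right _ _)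
  refine ⟨φ, ⟨hφ, ?_⟩, ?_⟩
  · calc eLpNorm (φ - ⇑v) 1 (volume.restrict Ω)
        ≤ (volume Ω + 1) * luxNorm Ω p (φ - ⇑v) := eLpNorm_one_le_luxNorm hΩ hΩ' hp _
      _ ≤ (volume Ω + 1) * (δ / (volume Ω + 1)) := by gcongr
      _ ≤ δ := ENNReal.mul_div_le
  · calc luxNorm Ω p (gradient φ)
        = luxNorm Ω p (weakGradient Ω v + (gradient φ - weakGradient Ω v)) := by
          rw [add_sub_cancel]
      _ ≤ luxNorm Ω p (weakGradient Ω v) + luxNorm Ω p (gradient φ - weakGradient Ω v) :=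
          luxNorm_add_le hΩ hp hpm hv.1.2.2.1 _
      _ < c := lt_tsub_iff_left.1 hltG

theorem iSup_iInf_modular_le_one_of_gammaLiminf_lt (hΩ : MeasurableSet Ω) (hΩ' : volume Ω ≠ ⊤)
    (hp : ∀ x ∈ Ω, 1 ≤ p x) (hpm : AEMeasurable p (volume.restrict Ω))
    {ph : ℕ → EuclideanSpace ℝ (Fin N) → ℝ} (hphm : ∀ h, AEMeasurable (ph h) (volume.restrict Ω))
    (hle : ∀ h, ∀ x ∈ Ω, p x ≤ ph h x)
    (hlim : Tendsto (fun h => eLpNorm (ph h - p) 1 (volume.restrict Ω)) atTop (𝓝 0))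
    {u : Lp ℝ 1 (volume.restrict Ω)} {m : ℝ}
    (hm : gammaLiminf (fun h => energy Ω (ph h)) u < ENNReal.ofReal m) :
    ⨆ n : ℕ, ⨅ φ ∈ testFunctionsNear Ω u ((n + 1 : ℕ) : ℝ≥0∞)⁻¹,
      modular Ω p (m⁻¹ • gradient φ) ≤ 1 := by
  refine iSup_le fun n => ENNReal.le_of_forall_pos_le_add fun ε hε _ => ?_
  set δ : ℝ≥0∞ := ((n + 1 : ℕ) : ℝ≥0∞)⁻¹
  have hδ : 0 < δ / 2 := ENNReal.half_pos (by simp [δ])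
  have hph (h x) (hx : x ∈ Ω) : 1 ≤ ph h x := (hp x hx).trans (hle h x hx)
  obtain ⟨h, ⟨v, hvu, hvm⟩, hclose⟩ :=
    ((frequently_exists_lt_of_gammaLiminf_lt hm (Metric.isOpen_eball (x := u) (ε := δ / 2))
      (Metric.mem_eball_self hδ)).and_eventually
      (hlim.eventually_le_const (ENNReal.coe_pos.2 hε))).exists
  obtain ⟨φ, hφ, hφm⟩ := exists_testFunction_of_energy_lt hΩ hΩ' (hph h) (hphm h) hvm hδ
  have hφu : eLpNorm (φ - ⇑u) 1 (volume.restrict Ω) ≤ δ := by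
    calc eLpNorm (φ - ⇑u) 1 (volume.restrict Ω)
        = eLpNorm ((φ - ⇑v) + (⇑v - ⇑u)) 1 (volume.restrict Ω) := by rw [sub_add_sub_cancel]
      _ ≤ eLpNorm (φ - ⇑v) 1 (volume.restrict Ω) + eLpNorm (⇑v - ⇑u) 1 (volume.restrict Ω) :=
          eLpNorm_add_le (hφ.1.aestronglyMeasurable.sub (Lp.aestronglyMeasurable v))
            ((Lp.aestronglyMeasurable v).sub (Lp.aestronglyMeasurable u)) le_rfl
      _ ≤ δ / 2 + δ / 2 := add_le_add hφ.2 ((Lp.edist_def v u).symm.trans_le hvu.le)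
      _ = δ := ENNReal.add_halves δ
  calc ⨅ φ ∈ testFunctionsNear Ω u δ, modular Ω p (m⁻¹ • gradient φ)
      ≤ modular Ω p (m⁻¹ • gradient φ) := iInf₂_le φ ⟨hφ.1, hφu⟩
    _ ≤ modular Ω (ph h) (m⁻¹ • gradient φ) + eLpNorm (ph h - p) 1 (volume.restrict Ω) :=
        modular_le_modular_add hΩ hp (hle h) hpm (hphm h) _
    _ ≤ 1 + ε := add_le_add (modular_inv_smul_le_one hΩ
        (fun x hx => zero_le_one.trans (hph h x hx)) hφm) hclose

end GammaLiminf

end VarExp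

open VarExp in
theorem theorem2p6_general {N : ℕ} (hN : 2 ≤ N) {Ω : Set (EuclideanSpace ℝ (Fin N))}
    (hΩ_open : IsOpen Ω) (hΩ_bdd : Bornology.IsBounded Ω) {p : EuclideanSpace ℝ (Fin N) → ℝ}
    (hp_cont : ContinuousOn p (closure Ω)) {a : ℝ} (ha : 1 < a) (hap : ∀ x ∈ Ω, a ≤ p x)
    {ph : ℕ → EuclideanSpace ℝ (Fin N) → ℝ}
    (hph : ∀ h, AEMeasurable (ph h) (volume.restrict Ω)) (hle : ∀ h, ∀ x ∈ Ω, p x ≤ ph h x)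
    (hlim : Tendsto (fun h => eLpNorm (ph h - p) 1 (volume.restrict Ω)) atTop (𝓝 0))
    (u : Lp ℝ 1 (volume.restrict Ω)) :
    energy Ω p u ≤ gammaLiminf (fun h => energy Ω (ph h)) u := by
  have hΩm := hΩ_open.measurableSet
  refine le_of_forall_gt_imp_ge_of_dense fun c hc => ?_
  rcases eq_or_ne c ⊤ with rfl | hc_top
  · exact le_top
  have hm : 0 < c.toReal := ENNReal.toReal_pos (zero_le.trans_lt hc).ne' hc_top
  rw [← ENNReal.ofReal_toReal hc_top] at hc ⊢
  exact energy_le_of_iSup_iInf_modular_le hN hΩ_open hΩ_bdd hp_cont ha hap u hm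
    (iSup_iInf_modular_le_one_of_gammaLiminf_lt hΩm hΩ_bdd.measure_lt_top.ne
      (fun x hx => ha.le.trans (hap x hx)) ((hp_cont.mono subset_closure).aemeasurable hΩm)
      hph hle hlim hc)

theorem theorem2p6 {N : ℕ} (hN : 2 ≤ N) (Ω : Set (EuclideanSpace ℝ (Fin N)))
    (hΩ_open : IsOpen Ω) (hΩ_conn : IsConnected Ω) (hΩ_bdd : Bornology.IsBounded Ω)
    (hΩ_lip : VarExp.HasLipschitzBoundary Ω)
    (p : EuclideanSpace ℝ (Fin N) → ℝ) (hp : VarExp.IsAdmissible Ω p)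
    (ph : ℕ → EuclideanSpace ℝ (Fin N) → ℝ) (hph : ∀ h, VarExp.IsAdmissible Ω (ph h))
    (hle : ∀ h, ∀ x ∈ Ω, p x ≤ ph h x)
    (hunif : TendstoUniformlyOn ph p atTop Ω)
    (u : Lp ℝ 1 (volume.restrict Ω)) :
    VarExp.energy Ω p u ≤ VarExp.gammaLiminf (fun h => VarExp.energy Ω (ph h)) u := by
  obtain ⟨a, ha, hap⟩ := hp.one_lt_inf
  exact theorem2p6_general hN hΩ_open hΩ_bdd hp.continuousOn ha hap
    (fun h => ((hph h).continuousOn.mono subset_closure).aemeasurable hΩ_open.measurableSet) hle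
    (VarExp.tendsto_eLpNorm_sub_of_tendstoUniformlyOn hΩ_open.measurableSet
      hΩ_bdd.measure_lt_top.ne hunif 1) u
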